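/- Let $\kappa>0$, $1<\alpha<\tfrac32$ and $T>0$. For $s\in\mathbb R$ let $\Lambda^s=(-\partial_{xx})^{s/2}$ be the Fourier multiplier on $\mathbb R$ with symbol $|\xi|^s$ (for the Fourier transform with kernel $e^{-ix\xi}$). Let $\dot H^s(\mathbb R)$ be the space of tempered distributions $v$ with $\hat v\in L^1_{\rm loc}$ and $\|v\|_{\dot H^s}:=\|\Lambda^s v\|_{L^2(\mathbb R)}<\infty$, and let $H^s(\mathbb R)$ be the space of tempered distributions $v$ with $\|v\|_{H^s}:=\|(1-\partial_{xx})^{s/2}v\|_{L^2(\mathbb R)}<\infty$. For $H=\dot H^s(\mathbb R)$ or $H=H^s(\mathbb R)$ put $\|w\|_{H^1(0,T;H)}^2=\|w\|_{L^2(0,T;H)}^2+\|w_t\|_{L^2(0,T;H)}^2$, where $w_t$ is the weak time derivative. Let $$X=H^1(0,T;\dot H^{-\alpha/2}(\mathbb R))\cap L^2(0,T;L^2(\mathbb R))\cap L^2(0,T;\dot H^{-\alpha}(\mathbb R)),$$ $$\|f\|_X=\|f\|_{H^1(0,T;\dot H^{-\alpha/2})}+\|f\|_{L^2(0,T;L^2)}+\|f\|_{L^2(0,T;\dot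 H^{-\alpha})}.$$ Elements of these spaces may be complex-valued, and their values at $t=0$ and $t=T$ are those of the continuous representative. Theorem. Let $f\in X$ satisfy $f(0)=f(T)$ in $\dot H^{-\alpha/2}(\mathbb R)$. Then there is a unique $$u\in H^1(0,T;H^{\alpha/2}(\mathbb R))\cap L^2(0,T;\dot H^{\alpha}(\mathbb R))$$ with $u(0)=u(T)$ in $H^{\alpha/2}(\mathbb R)$ that is a strong solution of $u_t+\kappa\Lambda^\alpha u=f$ on $(0,T)\times\mathbb R$, that is, with the equation holding in $L^2(\mathbb R)$ for almost every $t\in(0,T)$. Moreover $$\|u\|_{H^1(0,T;H^{\alpha/2}(\mathbb R))}+\|\Lambda^\alpha u\|_{L^2(0,T;L^2(\mathbb R))}\le\Big(1+\frac1\kappa\Big)\|f\|_X,$$ and if $f$ is real-valued, then so is $u$. -/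

import Mathlib

open MeasureTheory Set Filter Topology
open scoped SchwartzMap FourierTransform ENNReal ContDiff

noncomputable section

namespace FracHeat

/-! Distributions on the line are elements of `𝓢'(ℝ, ℂ)`; a time-dependent distribution is a map
`ℝ → 𝓢'(ℝ, ℂ)`, of which only the values on the time interval matter. -/

/-- The Fourier transform of `v` is the function `h`. (Integrability of `h` against every Schwartz
function contains local integrability of `h`.) -/
def IsFourierFun (v : 𝓢'(ℝ, ℂ)) (h : ℝ → ℂ) : Prop :=
  ∀ φ : 𝓢(ℝ, ℂ), Integrable (fun ξ => φ ξ * h ξ) ∧ (𝓕 v) φ = ∫ ξ, φ ξ * h ξ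

/-- `w` is obtained from `v` by multiplying the Fourier transform, a function, by the symbol `m`. -/
def IsMultiplier (m : ℝ → ℝ) (v w : 𝓢'(ℝ, ℂ)) : Prop :=
  ∃ h : ℝ → ℂ, IsFourierFun v h ∧ IsFourierFun w (fun ξ => (m ξ : ℂ) * h ξ)

/-- The symbol of `Λ ^ s = (-∂ₓₓ) ^ (s / 2)`. Mathlib's Fourier transform has the kernel
`exp (-2πixξ)`, so that `-∂ₓₓ` has the symbol `(2π|ξ|)²`. -/
def rieszSymbol (s : ℝ) (ξ : ℝ) : ℝ := (2 * Real.pi * |ξ|) ^ s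

/-- The symbol of `(1 - ∂ₓₓ) ^ (s / 2)`. -/
def besselSymbol (s : ℝ) (ξ : ℝ) : ℝ := (1 + (2 * Real.pi * |ξ|) ^ 2) ^ (s / 2)

/-- `L²(ℝ)`. -/
abbrev L2 : Type := Lp ℂ 2 (volume : Measure ℝ)

/-- `v` belongs to the Sobolev space with symbol `m`, and `g` in `L²(ℝ)` is the result of applying
the multiplier `m` to `v`; the norm of `v` in that space is the `L²` norm of `g`.
For `m = besselSymbol s` this is `H ^ s`, for `m = rieszSymbol s` the homogeneous space (which is
`L²(ℝ)` itself when `s = 0`). -/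
def SobolevLift (m : ℝ → ℝ) (v : 𝓢'(ℝ, ℂ)) (g : L2) : Prop :=
  IsMultiplier m v (g : 𝓢'(ℝ, ℂ))

/-- Lebesgue measure on the time interval `(0, T)`. -/
def timeMeasure (T : ℝ) : Measure ℝ := volume.restrict (Ioo 0 T)

/-- The norm of `u` in `L²(0, T; H)`, where `H` is the Sobolev space with symbol `m`; it is `∞` if
`u` is not in that space. The map `g`, unique almost everywhere, is the image of `u` under the
isometry of `H` into `L²(ℝ)`. -/
def normL2 (T : ℝ) (m : ℝ → ℝ) (u : ℝ → 𝓢'(ℝ, ℂ)) : ℝ≥0∞ :=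
  ⨅ (g : ℝ → L2) (_ : AEStronglyMeasurable g (timeMeasure T) ∧
    ∀ᵐ t ∂(timeMeasure T), SobolevLift m (u t) (g t)), eLpNorm g 2 (timeMeasure T)

/-- `u'` is the weak time derivative of `u` on `(0, T)`. -/
def IsTimeDeriv (T : ℝ) (u u' : ℝ → 𝓢'(ℝ, ℂ)) : Prop :=
  ∀ φ : 𝓢(ℝ, ℂ),
    Integrable (fun t => u t φ) (timeMeasure T) ∧ Integrable (fun t => u' t φ) (timeMeasure T) ∧
    ∀ η : ℝ → ℝ, ContDiff ℝ ∞ η → HasCompactSupport η → tsupport η ⊆ Ioo 0 T →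
      ∫ t, ((deriv η t : ℝ) : ℂ) * u t φ ∂(timeMeasure T) =
        -∫ t, (η t : ℂ) * u' t φ ∂(timeMeasure T)

/-- The norm of `u` in `H¹(0, T; H)`, where `H` is the Sobolev space with symbol `m`; it is `∞` if
`u` is not in that space. -/
def normH1 (T : ℝ) (m : ℝ → ℝ) (u : ℝ → 𝓢'(ℝ, ℂ)) : ℝ≥0∞ :=
  ⨅ (u' : ℝ → 𝓢'(ℝ, ℂ)) (_ : IsTimeDeriv T u u'),
    (normL2 T m u ^ 2 + normL2 T m u' ^ 2) ^ (1 / 2 : ℝ)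

/-- `u`, as an element of `H¹(0, T; H)`, takes the same value at the times `0` and `T`: it agrees
almost everywhere on `(0, T)` with some `U` in `C([0, T]; H)` with `U 0 = U T`. -/
def EqAtEndpoints (T : ℝ) (m : ℝ → ℝ) (u : ℝ → 𝓢'(ℝ, ℂ)) : Prop :=
  ∃ U : ℝ → 𝓢'(ℝ, ℂ), (∀ᵐ t ∂(timeMeasure T), u t = U t) ∧
    (∃ g : ℝ → L2, ContinuousOn g (Icc 0 T) ∧ ∀ t ∈ Icc 0 T, SobolevLift m (U t) (g t)) ∧
    U 0 = U T

/-- The norm of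
`X = H¹(0, T; Ḣ ^ (-α/2)) ∩ L²(0, T; L²) ∩ L²(0, T; Ḣ ^ (-α))`; it is `∞` outside `X`. -/
def normX (α T : ℝ) (f : ℝ → 𝓢'(ℝ, ℂ)) : ℝ≥0∞ :=
  normH1 T (rieszSymbol (-(α / 2))) f + normL2 T (rieszSymbol 0) f + normL2 T (rieszSymbol (-α)) f

/-- The norm of `Y = H¹(0, T; H ^ (α/2)) ∩ L²(0, T; Ḣ ^ α)`, that is,
`‖u‖_{H¹(0, T; H ^ (α/2))} + ‖Λ ^ α u‖_{L²(0, T; L²)}`; it is `∞` outside `Y`. -/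
def normY (α T : ℝ) (u : ℝ → 𝓢'(ℝ, ℂ)) : ℝ≥0∞ :=
  normH1 T (besselSymbol (α / 2)) u + normL2 T (rieszSymbol α) u

/-- `u` is a `T`-periodic strong solution of `u_t + κ Λ ^ α u = f`: it lies in `Y`, the equation
holds for almost every time with `Λ ^ α u` in `L²(ℝ)`, and `u(0) = u(T)` in `H ^ (α/2)`. -/
def IsPeriodicStrongSolution (κ α T : ℝ) (f u : ℝ → 𝓢'(ℝ, ℂ)) : Prop :=
  normY α T u < ⊤ ∧
  (∃ u' : ℝ → 𝓢'(ℝ, ℂ), IsTimeDeriv T u u' ∧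
    ∀ᵐ t ∂(timeMeasure T), ∃ w : L2, IsMultiplier (rieszSymbol α) (u t) (w : 𝓢'(ℝ, ℂ)) ∧
      u' t + (κ : ℂ) • (w : 𝓢'(ℝ, ℂ)) = f t) ∧
  EqAtEndpoints T (besselSymbol (α / 2)) u

/-- The distribution `v` is real: it takes real values on real test functions. -/
def IsRealDistribution (v : 𝓢'(ℝ, ℂ)) : Prop :=
  ∀ φ : 𝓢(ℝ, ℂ), (∀ x, (φ x).im = 0) → (v φ).im = 0

end FracHeat

end

noncomputable section

namespace FracHeat

/-! ### Fourier series on `(0, T)` with values in a Hilbert space -/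

/-! The Fourier transform in `x` and a Fourier series in `t` make the equation algebraic. With time
frequency `τ = freq T k` and `r = rieszSymbol α ξ`, a periodic solution must have coefficients `q ·
f_k(ξ)`, where `q = 1 / (iτ + κ r)`. The denominator vanishes at most at `ξ = 0`, a null set, so
uniqueness follows, and existence amounts to bounding multipliers.

From `|q|² = 1 / (τ² + κ² r²)` one has `r |q| ≤ 1/κ` and `|τ| |q| ≤ 1`. There is no spectral gap at
`ξ = 0`, and the negative-order norms of `f` make up for it. The squared Bessel symbol is at most `1
+ r = (r⁻² + r⁻¹) r²`, so `u` in `H^(α/2)` costs `κ⁻²(r⁻² + r⁻¹)`, the weights of `Ḣ^(-α)` and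
`Ḣ^(-α/2)`. For `u_t` the same splitting costs `1 + κ⁻² τ² r⁻¹`, the weights of `f` in `L²` and of
`f_t` in `Ḣ^(-α/2)`. Parseval (`hasSum_norm_coeff_sq`, used through `exists_multiplier`) turns these
pointwise bounds into norms, and `sum_norms_le` collects the constant.

The link with weak derivatives on the open interval is `coeff_weakDeriv`: equal end values remove
the boundary terms, so differentiation multiplies the coefficients by `iτ`. The converse is
`isWeakDeriv_of_coeff`. Unbounded symbols are rewritten with bounded operators (`ae_eq_mul_iff`) in
order to commute with integrals in time. Reality is the symmetry of `q` under conjugation combined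
with `(τ, ξ) ↦ (-τ, -ξ)`. -/

instance isFiniteMeasure_timeMeasure (T : ℝ) : IsFiniteMeasure (timeMeasure T) := by
  unfold timeMeasure; infer_instance

/-- The frequencies of `T`-periodic functions. -/
def freq (T : ℝ) (k : ℤ) : ℝ := 2 * Real.pi * k / T

/-- The orthonormal basis of exponentials in `L²(0, T)`. -/
def wave (T : ℝ) (k : ℤ) (t : ℝ) : ℂ :=
  (((√T)⁻¹ : ℝ) : ℂ) * Complex.exp (((freq T k * t : ℝ) : ℂ) * Complex.I)

lemma continuous_wave (T : ℝ) (k : ℤ) : Continuous (wave T k) := by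
  unfold wave; fun_prop

lemma norm_wave (T : ℝ) (k : ℤ) (t : ℝ) : ‖wave T k t‖ = (√T)⁻¹ := by
  rw [wave, norm_mul, Complex.norm_exp_ofReal_mul_I, mul_one, Complex.norm_real, Real.norm_eq_abs,
    abs_of_nonneg (by positivity)]

lemma hasDerivAt_wave (T : ℝ) (k : ℤ) (t : ℝ) :
    HasDerivAt (wave T k) ((freq T k : ℂ) * Complex.I * wave T k t) t := by
  unfold wave
  have h : HasDerivAt (fun t : ℝ => ((freq T k * t : ℝ) : ℂ) * Complex.I)
      ((freq T k : ℂ) * Complex.I) t := by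
    have := ((hasDerivAt_id t).const_mul (freq T k)).ofReal_comp.mul_const Complex.I
    simpa using this
  convert! (h.cexp.const_mul (((√T)⁻¹ : ℝ) : ℂ)) using 1
  ring

lemma conj_wave (T : ℝ) (k : ℤ) (t : ℝ) : starRingEnd ℂ (wave T k t) = wave T (-k) t := by
  simp only [wave, map_mul, Complex.conj_ofReal, ← Complex.exp_conj, Complex.conj_I]
  congr 2
  simp only [freq]
  push_cast
  ring

lemma freq_neg (T : ℝ) (k : ℤ) : freq T (-k) = -freq T k := by
  simp only [freq]; push_cast; ring

lemma wave_end {T : ℝ} (hT : 0 < T) (k : ℤ) : wave T k T = wave T k 0 := by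
  have h : freq T k * T = k * (2 * Real.pi) := by
    unfold freq; field_simp
  have h2 : ((((k : ℝ) * (2 * Real.pi) : ℝ) : ℂ)) * Complex.I
      = (k : ℂ) * (2 * Real.pi * Complex.I) := by push_cast; ring
  simp only [wave, h, h2, Complex.exp_int_mul_two_pi_mul_I]
  simp

/-- The `k`-th Fourier coefficient over `(0, T)`. -/
def coeff {E : Type*} [NormedAddCommGroup E] [NormedSpace ℂ E]
    (T : ℝ) (k : ℤ) (F : ℝ → E) : E :=
  ∫ t, starRingEnd ℂ (wave T k t) • F t ∂(timeMeasure T)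

lemma integral_conj_wave_mul_wave {T : ℝ} (hT : 0 < T) (i j : ℤ) :
    ∫ t, starRingEnd ℂ (wave T i t) * wave T j t ∂(timeMeasure T) = if i = j then 1 else 0 := by
  have hs : (√T)⁻¹ * (√T)⁻¹ = T⁻¹ := by
    rw [← mul_inv, Real.mul_self_sqrt hT.le]
  have h1 : ∀ t, starRingEnd ℂ (wave T i t) * wave T j t
      = (T⁻¹ : ℂ) * Complex.exp ((freq T (j - i) : ℂ) * Complex.I * t) := by
    intro t
    rw [conj_wave, wave, wave, mul_mul_mul_comm, ← Complex.ofReal_mul, hs, ← Complex.exp_add]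
    push_cast
    congr 2
    simp only [freq]
    push_cast
    ring
  simp only [h1, timeMeasure]
  rw [← integral_Ioc_eq_integral_Ioo, ← intervalIntegral.integral_of_le hT.le]
  rw [intervalIntegral.integral_const_mul]
  split_ifs with h
  · subst h
    simp [freq, hT.ne']
  · have hne : (freq T (j - i) : ℂ) * Complex.I ≠ 0 := by
      have : freq T (j - i) ≠ 0 := by
        unfold freq
        have : ((j - i : ℤ) : ℝ) ≠ 0 := by exact_mod_cast sub_ne_zero.2 (Ne.symm h)
        have := Real.pi_pos
        positivity
      exact mul_ne_zero (by exact_mod_cast this) Complex.I_ne_zero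
    rw [integral_exp_mul_complex hne]
    have h3 : (freq T (j - i) : ℂ) * Complex.I * T =
        ((j - i : ℤ) : ℂ) * (2 * Real.pi * Complex.I) := by
      have : (T : ℂ) ≠ 0 := by exact_mod_cast hT.ne'
      unfold freq; push_cast; field_simp
    rw [h3, Complex.exp_int_mul_two_pi_mul_I]
    simp

section Hilbert

variable {E : Type*} [NormedAddCommGroup E] [NormedSpace ℂ E]

lemma integrable_conj_wave_smul {T : ℝ} (k : ℤ) {F : ℝ → E} (hF : Integrable F (timeMeasure T)) :
    Integrable (fun t => starRingEnd ℂ (wave T k t) • F t) (timeMeasure T) := by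
  refine hF.bdd_smul (√T)⁻¹ ?_ ?_
  · exact (Complex.continuous_conj.comp (continuous_wave T k)).aestronglyMeasurable
  · exact ae_of_all _ fun t => by simp [norm_wave]

lemma coeff_congr {T : ℝ} (k : ℤ) {F G : ℝ → E} (h : F =ᵐ[timeMeasure T] G) :
    coeff T k F = coeff T k G :=
  integral_congr_ae (by filter_upwards [h] with t ht; rw [ht])

lemma coeff_add_smul {T : ℝ} (k : ℤ) {F G : ℝ → E} (c : ℂ) (hF : Integrable F (timeMeasure T))
    (hG : Integrable G (timeMeasure T)) :
    coeff T k (fun t => F t + c • G t) = coeff T k F + c • coeff T k G := by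
  simp only [coeff, smul_add, smul_comm _ c]
  rw [← integral_smul]
  exact integral_add (integrable_conj_wave_smul k hF) ((integrable_conj_wave_smul k hG).smul c)

lemma coeff_clm {E' : Type*} [NormedAddCommGroup E'] [NormedSpace ℂ E'] [CompleteSpace E]
    [CompleteSpace E'] {T : ℝ} (k : ℤ) (B : E →L[ℂ] E') {F : ℝ → E}
    (hF : Integrable F (timeMeasure T)) :
    coeff T k (fun t => B (F t)) = B (coeff T k F) := by
  simp only [coeff]
  rw [← ContinuousLinearMap.integral_comp_comm B (integrable_conj_wave_smul k hF)]
  simp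

end Hilbert

/-- Up to a constant factor these are the coefficients on the circle, so Parseval there forces `∫
‖y‖² = 0`. -/
lemma ae_eq_zero_of_coeff_eq_zero {T : ℝ} (hT : 0 < T) {y : ℝ → ℂ}
    (hy : MemLp y 2 (timeMeasure T)) (h : ∀ k, coeff T k y = 0) : y =ᵐ[timeMeasure T] 0 := by
  have hμ : timeMeasure T = volume.restrict (Ioc 0 T) := by
    rw [timeMeasure]; exact Measure.restrict_congr_set Ioo_ae_eq_Ioc
  rw [hμ] at hy
  have hk : ∀ k, fourierCoeffOn hT y k = 0 := by
    intro k
    rw [fourierCoeffOn_eq_integral]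
    have h1 := h k
    rw [coeff, hμ, ← intervalIntegral.integral_of_le hT.le] at h1
    have h2 : ∀ x : ℝ, starRingEnd ℂ (wave T k x) • y x =
        (((√T)⁻¹ : ℝ) : ℂ) * (fourier (-k) (x : AddCircle (T - 0)) • y x) := by
      intro x
      rw [fourier_coe_apply, conj_wave, wave, smul_eq_mul, smul_eq_mul, mul_assoc]
      congr 3
      simp only [freq]
      push_cast
      rw [sub_zero]
      ring
    simp only [h2, intervalIntegral.integral_const_mul] at h1
    have h3 : (((√T)⁻¹ : ℝ) : ℂ) ≠ 0 := by
      have := Real.sqrt_pos.2 hT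
      exact_mod_cast (inv_pos.2 this).ne'
    rw [(mul_eq_zero.1 h1).resolve_left h3, smul_zero]
  have hs := hasSum_sq_fourierCoeffOn hT hy
  simp only [hk, norm_zero, ne_eq, OfNat.ofNat_ne_zero, not_false_eq_true, zero_pow] at hs
  have h0 := hs.unique hasSum_zero
  rw [intervalIntegral.integral_of_le hT.le, smul_eq_mul, sub_zero] at h0
  have h0' := (mul_eq_zero.1 h0).resolve_left (inv_ne_zero hT.ne')
  rw [integral_eq_zero_iff_of_nonneg (fun x => by positivity)] at h0'
  · rw [hμ]
    filter_upwards [h0'] with x hx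
    simpa using hx
  · exact (memLp_two_iff_integrable_sq_norm hy.1).1 hy

section Inner

variable {H : Type*} [NormedAddCommGroup H] [InnerProductSpace ℂ H]

lemma memLp_wave_smul {T : ℝ} (k : ℤ) (h : H) :
    MemLp (fun t => wave T k t • h) 2 (timeMeasure T) := by
  refine MemLp.of_bound (C := (√T)⁻¹ * ‖h‖) ?_ ?_
  · exact ((continuous_wave T k).smul continuous_const).aestronglyMeasurable
  · exact ae_of_all _ fun t => by rw [norm_smul, norm_wave]

lemma coeff_toLp {T : ℝ} (k : ℤ) {F : ℝ → H} (hF : MemLp F 2 (timeMeasure T)) :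
    coeff T k (hF.toLp F) = coeff T k F :=
  coeff_congr k hF.coeFn_toLp

variable [CompleteSpace H]

lemma inner_toLp_wave {T : ℝ} (k : ℤ) (h : H) (F : Lp H 2 (timeMeasure T)) :
    inner ℂ ((memLp_wave_smul k h).toLp _) F = inner ℂ h (coeff T k F) := by
  have hF : Integrable F (timeMeasure T) := (Lp.memLp F).integrable one_le_two
  rw [L2.inner_def, coeff]
  have := ContinuousLinearMap.integral_comp_comm (innerSL ℂ h) (integrable_conj_wave_smul k hF)
  simp only [innerSL_apply_apply] at this
  rw [← this]
  apply integral_congr_ae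
  filter_upwards [(memLp_wave_smul (T := T) k h).coeFn_toLp] with t ht
  rw [ht, inner_smul_left, inner_smul_right]

lemma coeff_wave_smul {T : ℝ} (hT : 0 < T) (i j : ℤ) (h : H) :
    coeff T i (fun t => wave T j t • h) = if i = j then h else 0 := by
  simp only [coeff, smul_smul]
  rw [integral_smul_const, integral_conj_wave_mul_wave hT]
  split_ifs <;> simp

/-- The wave of frequency `k` with amplitude in `H`. -/
def waveIsometry (H : Type*) [NormedAddCommGroup H] [InnerProductSpace ℂ H] [CompleteSpace H]
    {T : ℝ} (hT : 0 < T) (k : ℤ) : H →ₗᵢ[ℂ] Lp H 2 (timeMeasure T) :=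
  LinearMap.isometryOfInner
    { toFun := fun h => (memLp_wave_smul k h).toLp _
      map_add' := fun x y => by
        rw [← MemLp.toLp_add]
        congr 1
        ext t
        simp
      map_smul' := fun c x => by
        rw [RingHom.id_apply, ← MemLp.toLp_const_smul]
        congr 1
        ext t
        simp [smul_comm c] }
    (fun x y => by
      simp only [LinearMap.coe_mk, AddHom.coe_mk]
      rw [inner_toLp_wave, coeff_toLp, coeff_wave_smul hT, if_pos rfl])

lemma inner_waveIsometry {T : ℝ} (hT : 0 < T) (k : ℤ) (h : H) (F : Lp H 2 (timeMeasure T)) :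
    inner ℂ (waveIsometry H hT k h) F = inner ℂ h (coeff T k F) :=
  inner_toLp_wave k h F

lemma coeff_waveIsometry {T : ℝ} (hT : 0 < T) (i j : ℤ) (h : H) :
    coeff T i (waveIsometry H hT j h) = if i = j then h else 0 := by
  refine (coeff_toLp i (memLp_wave_smul j h)).trans (coeff_wave_smul hT i j h)

lemma orthogonalFamily_wave {T : ℝ} (hT : 0 < T) :
    OrthogonalFamily ℂ (fun _ : ℤ => H) (waveIsometry H hT) := by
  intro i j hij x y
  rw [inner_waveIsometry, coeff_waveIsometry, if_neg hij, inner_zero_right]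

variable [SecondCountableTopology H]

/-- Pairing with a fixed vector reduces to the scalar case; separability of `H` allows one
exceptional null set for all vectors. -/
lemma ae_eq_zero_of_forall_coeff_eq_zero {T : ℝ} (hT : 0 < T) {F : ℝ → H}
    (hF : MemLp F 2 (timeMeasure T)) (h : ∀ k, coeff T k F = 0) : F =ᵐ[timeMeasure T] 0 := by
  refine ae_eq_zero_of_forall_inner (𝕜 := ℂ) fun c => ?_
  refine ae_eq_zero_of_coeff_eq_zero hT (hF.const_inner c) fun k => ?_
  have := coeff_clm k (innerSL ℂ c) (hF.integrable one_le_two)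
  simp only [innerSL_apply_apply] at this
  rw [this, h, inner_zero_right]

lemma isHilbertSum_wave {T : ℝ} (hT : 0 < T) :
    IsHilbertSum ℂ (fun _ : ℤ => H) (waveIsometry H hT) := by
  refine IsHilbertSum.mk (orthogonalFamily_wave hT) ?_
  rw [top_le_iff, Submodule.topologicalClosure_eq_top_iff, Submodule.eq_bot_iff]
  intro F hF
  have hk : ∀ k, coeff T k F = 0 := by
    intro k
    refine ext_inner_left ℂ fun v => ?_
    rw [← inner_waveIsometry hT, inner_zero_right]
    exact (Submodule.mem_orthogonal _ F).1 hF _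
      (Submodule.mem_iSup_of_mem k (LinearMap.mem_range_self _ v))
  exact (Lp.eq_zero_iff_ae_eq_zero).2 (ae_eq_zero_of_forall_coeff_eq_zero hT (Lp.memLp F) hk)

/-- The isometry of `L²(0, T; H)` with the square summable sequences in `H`. -/
def seriesEquiv (H : Type*) [NormedAddCommGroup H] [InnerProductSpace ℂ H] [CompleteSpace H]
    [SecondCountableTopology H] {T : ℝ} (hT : 0 < T) :
    Lp H 2 (timeMeasure T) ≃ₗᵢ[ℂ] lp (fun _ : ℤ => H) 2 :=
  (isHilbertSum_wave hT).linearIsometryEquiv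

/-- The abstract equivalence sends waves to sequences with a single nonzero entry, so pairing with a
wave reads off the `k`-th entry. -/
lemma seriesEquiv_apply {T : ℝ} (hT : 0 < T) (F : Lp H 2 (timeMeasure T)) (k : ℤ) :
    seriesEquiv H hT F k = coeff T k F := by
  refine ext_inner_left ℂ fun v => ?_
  rw [← inner_waveIsometry hT, ← lp.inner_single_left k v (seriesEquiv H hT F),
    ← (isHilbertSum_wave hT).linearIsometryEquiv_symm_apply_single]
  exact (LinearIsometryEquiv.inner_map_eq_flip _ _ _).symm

lemma hasSum_norm_coeff_sq {T : ℝ} (hT : 0 < T) (F : Lp H 2 (timeMeasure T)) :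
    HasSum (fun k => ‖coeff T k F‖ ^ 2) (‖F‖ ^ 2) := by
  have := lp.hasSum_norm (p := 2) (by norm_num) (seriesEquiv H hT F)
  rw [LinearIsometryEquiv.norm_map] at this
  simpa [seriesEquiv_apply] using this

lemma hasSum_inner_coeff {T : ℝ} (hT : 0 < T) (F G : Lp H 2 (timeMeasure T)) :
    HasSum (fun k => inner ℂ (coeff T k F) (coeff T k G)) (inner ℂ F G) := by
  have := lp.hasSum_inner (𝕜 := ℂ) (seriesEquiv H hT F) (seriesEquiv H hT G)
  rw [LinearIsometryEquiv.inner_map_map] at this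
  simpa [seriesEquiv_apply] using this

lemma ae_eq_of_coeff_eq {T : ℝ} (hT : 0 < T) {F G : ℝ → H}
    (hF : MemLp F 2 (timeMeasure T)) (hG : MemLp G 2 (timeMeasure T))
    (h : ∀ k, coeff T k F = coeff T k G) : F =ᵐ[timeMeasure T] G := by
  refine (MemLp.toLp_eq_toLp_iff hF hG).1 ?_
  apply (seriesEquiv H hT).injective
  ext k
  rw [seriesEquiv_apply, seriesEquiv_apply, coeff_toLp, coeff_toLp, h]

lemma exists_coeff_eq {T : ℝ} (hT : 0 < T) {c : ℤ → H} (hc : Summable fun k => ‖c k‖ ^ 2) :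
    ∃ F : Lp H 2 (timeMeasure T), ∀ k, coeff T k F = c k := by
  have hm : Memℓp c 2 := by
    rw [memℓp_gen_iff (by norm_num)]
    simpa using hc
  refine ⟨(seriesEquiv H hT).symm ⟨c, hm⟩, fun k => ?_⟩
  rw [← seriesEquiv_apply hT, LinearIsometryEquiv.apply_symm_apply]

/-- A function in `H¹` of the circle has a continuous periodic representative. -/
lemma exists_continuous_periodic {T : ℝ} (hT : 0 < T) {F : ℝ → H}
    (hF : MemLp F 2 (timeMeasure T))
    (h1 : Summable fun k => (freq T k * ‖coeff T k F‖) ^ 2) :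
    ∃ g : ℝ → H, Continuous g ∧ g 0 = g T ∧ F =ᵐ[timeMeasure T] g := by
  -- For `k ≠ 0`, write `‖c_k‖ = (1/k) · (k ‖c_k‖)` and bound the product by the sum of the two
  -- squares.
  have hs : Summable fun k => ‖coeff T k F‖ := by
    have h2 : Summable fun k : ℤ => 1 / (k : ℝ) ^ 2 := Real.summable_one_div_int_pow.2 (by norm_num)
    have hpos : 0 < 2 * Real.pi / T := by positivity
    refine Summable.of_norm_bounded_eventually
      (g := fun k : ℤ => 1 / (k : ℝ) ^ 2 + ((2 * Real.pi / T)⁻¹) ^ 2 *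
        (freq T k * ‖coeff T k F‖) ^ 2) ((h2.add (h1.mul_left _))) ?_
    have : ∀ᶠ k : ℤ in cofinite, k ≠ 0 := by
      rw [eventually_cofinite]; simp
    filter_upwards [this] with k hk
    have hk' : (k : ℝ) ≠ 0 := by exact_mod_cast hk
    rw [norm_norm]
    have e : ((2 * Real.pi / T)⁻¹) ^ 2 * (freq T k * ‖coeff T k F‖) ^ 2
        = (k * ‖coeff T k F‖) ^ 2 := by
      have := Real.pi_pos
      unfold freq; field_simp
    rw [e]
    have key : ‖coeff T k F‖ = (1 / (k : ℝ)) * (k * ‖coeff T k F‖) := by field_simp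
    have := two_mul_le_add_sq (1 / (k : ℝ)) (k * ‖coeff T k F‖)
    rw [mul_assoc, ← key, div_pow, one_pow] at this
    nlinarith [norm_nonneg (coeff T k F)]
  have hs' : Summable fun k => (√T)⁻¹ * ‖coeff T k F‖ := hs.mul_left _
  have hb : ∀ k t, ‖wave T k t • coeff T k F‖ ≤ (√T)⁻¹ * ‖coeff T k F‖ := fun k t => by
    rw [norm_smul, norm_wave]
  -- The Weierstrass test gives continuity; the limit is then identified with `F` through its
  -- coefficients.
  have hcont : Continuous fun t => ∑' k, wave T k t • coeff T k F :=
    continuous_tsum (fun k => (continuous_wave T k).smul continuous_const) hs' hb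
  have hB : ∀ t, ‖∑' k, wave T k t • coeff T k F‖ ≤ ∑' k, (√T)⁻¹ * ‖coeff T k F‖ := fun t =>
    tsum_of_norm_bounded hs'.hasSum fun k => hb k t
  have hg : MemLp (fun t => ∑' k, wave T k t • coeff T k F) 2 (timeMeasure T) :=
    MemLp.of_bound hcont.aestronglyMeasurable _ (ae_of_all _ hB)
  refine ⟨_, hcont, by simp only [wave_end hT], ae_eq_of_coeff_eq hT hF hg fun j => ?_⟩
  have hsum : HasSum (fun k => ∫ t, starRingEnd ℂ (wave T j t) • (wave T k t • coeff T k F)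
      ∂(timeMeasure T)) (∫ t, ∑' k, starRingEnd ℂ (wave T j t) • (wave T k t • coeff T k F)
      ∂(timeMeasure T)) := by
    refine hasSum_integral_of_summable_integral_norm (fun k => ?_) ?_
    · exact integrable_conj_wave_smul j ((memLp_wave_smul k _).integrable one_le_two)
    · simp only [norm_smul, RCLike.norm_conj, norm_wave, integral_const]
      exact ((hs.mul_left _).mul_left _).mul_left _
  have e2 : ∀ k, ∫ t, starRingEnd ℂ (wave T j t) • (wave T k t • coeff T k F)
      ∂(timeMeasure T) = if j = k then coeff T k F else 0 := fun k => coeff_wave_smul hT j k _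
  simp only [e2] at hsum
  have e3 : HasSum (fun k => if j = k then coeff T k F else 0) (coeff T j F) := by
    convert! hasSum_ite_eq j (coeff T j F) using 2 with k
    split_ifs with h h' h'
    · rw [h]
    · exact absurd h.symm h'
    · exact absurd h'.symm h
    · rfl
  rw [e3.unique hsum, coeff]
  refine integral_congr_ae (ae_of_all _ fun t => ?_)
  exact tsum_const_smul'' _

end Inner

/-! ### Weak time derivatives and Fourier coefficients -/

/-- `y'` is the weak derivative of the scalar function `y` on `(0, T)`. -/
def IsWeakDeriv (T : ℝ) (y y' : ℝ → ℂ) : Prop :=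
  ∀ η : ℝ → ℝ, ContDiff ℝ ∞ η → HasCompactSupport η → tsupport η ⊆ Ioo 0 T →
    ∫ t, ((deriv η t : ℝ) : ℂ) * y t ∂(timeMeasure T) = -∫ t, (η t : ℂ) * y' t ∂(timeMeasure T)

lemma integrable_ofReal_mul {T : ℝ} {η : ℝ → ℝ} (hc : Continuous η) (hs : HasCompactSupport η)
    {y : ℝ → ℂ} (hy : Integrable y (timeMeasure T)) :
    Integrable (fun t => (η t : ℂ) * y t) (timeMeasure T) := by
  obtain ⟨C, hC⟩ := hs.exists_bound_of_continuous hc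
  refine hy.bdd_mul (c := C) ?_ (ae_of_all _ fun t => ?_)
  · exact (Complex.continuous_ofReal.comp hc).aestronglyMeasurable
  · simpa using hC t

lemma hasCompactSupport_of_subset_Ioo {T : ℝ} {E : Type*} [Zero E] {z : ℝ → E}
    (hz : tsupport z ⊆ Ioo 0 T) : HasCompactSupport z :=
  isCompact_Icc.of_isClosed_subset (isClosed_tsupport z) (hz.trans Ioo_subset_Icc_self)

/-- Splitting into real and imaginary parts extends the identity to complex test functions, as
needed for a cutoff times a wave. -/
lemma IsWeakDeriv.complex {T : ℝ} {y y' : ℝ → ℂ} (hw : IsWeakDeriv T y y')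
    (hy : Integrable y (timeMeasure T)) (hy' : Integrable y' (timeMeasure T))
    {z : ℝ → ℂ} (hz : ContDiff ℝ ∞ z) (hs : tsupport z ⊆ Ioo 0 T) :
    ∫ t, deriv z t * y t ∂(timeMeasure T) = -∫ t, z t * y' t ∂(timeMeasure T) := by
  have hd : ∀ t, HasDerivAt z (deriv z t) t := fun t =>
    (hz.differentiable (by simp) t).hasDerivAt
  have hre : ContDiff ℝ ∞ fun t => (z t).re := Complex.reCLM.contDiff.comp hz
  have him : ContDiff ℝ ∞ fun t => (z t).im := Complex.imCLM.contDiff.comp hz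
  have sre : tsupport (fun t => (z t).re) ⊆ Ioo 0 T :=
    (closure_mono fun t ht => by
      simp only [Function.mem_support] at ht ⊢
      exact fun h => ht (by simp [h])).trans hs
  have sim : tsupport (fun t => (z t).im) ⊆ Ioo 0 T :=
    (closure_mono fun t ht => by
      simp only [Function.mem_support] at ht ⊢
      exact fun h => ht (by simp [h])).trans hs
  have cre := hasCompactSupport_of_subset_Ioo sre
  have cim := hasCompactSupport_of_subset_Ioo sim
  have dre : ∀ t, deriv (fun t => (z t).re) t = (deriv z t).re := fun t =>
    (Complex.reCLM.hasFDerivAt.comp_hasDerivAt t (hd t)).deriv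
  have dim : ∀ t, deriv (fun t => (z t).im) t = (deriv z t).im := fun t =>
    (Complex.imCLM.hasFDerivAt.comp_hasDerivAt t (hd t)).deriv
  have e1 := hw _ hre cre sre
  have e2 := hw _ him cim sim
  have i1 := integrable_ofReal_mul (hre.continuous_deriv (by simp)) cre.deriv hy
  have i2 := integrable_ofReal_mul (him.continuous_deriv (by simp)) cim.deriv hy
  have i3 := integrable_ofReal_mul hre.continuous cre hy'
  have i4 := integrable_ofReal_mul him.continuous cim hy'
  calc ∫ t, deriv z t * y t ∂(timeMeasure T)
      = ∫ t, ((deriv (fun t => (z t).re) t : ℝ) : ℂ) * y t +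
          Complex.I * (((deriv (fun t => (z t).im) t : ℝ) : ℂ) * y t) ∂(timeMeasure T) := by
        refine integral_congr_ae (ae_of_all _ fun t => ?_)
        simp only [dre, dim]
        conv_lhs => rw [← Complex.re_add_im (deriv z t)]
        ring
    _ = -∫ t, ((z t).re : ℂ) * y' t + Complex.I * (((z t).im : ℂ) * y' t) ∂(timeMeasure T) := by
        rw [integral_add i1 (i2.const_mul _), integral_add i3 (i4.const_mul _),
          integral_const_mul, integral_const_mul, e1, e2]
        ring
    _ = _ := by
        congr 1
        refine integral_congr_ae (ae_of_all _ fun t => ?_)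
        beta_reduce
        conv_rhs => rw [← Complex.re_add_im (z t)]
        ring

/-! ### Cutoffs in time and the boundary terms. -/

/-- A smooth cutoff function on `(0, T)`, which tends to `1` there as `ε` tends to `0`. -/
def cutoff (T ε t : ℝ) : ℝ := Real.smoothTransition (t * (T - t) / ε - 1)

lemma deriv_smoothTransition_of_one_lt {x : ℝ} (h : 1 < x) : deriv Real.smoothTransition x = 0 := by
  have : Real.smoothTransition =ᶠ[𝓝 x] fun _ => 1 := by
    filter_upwards [Ioi_mem_nhds h] with y hy
    exact Real.smoothTransition.one_of_one_le (le_of_lt hy)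
  rw [this.deriv_eq]; simp

/-- The derivative is continuous and vanishes outside `[0, 1]`. -/
lemma exists_deriv_smoothTransition_le : ∃ C : ℝ, 0 ≤ C ∧
    ∀ x, |deriv Real.smoothTransition x| ≤ C := by
  have hc : Continuous (deriv Real.smoothTransition) :=
    (Real.smoothTransition.contDiff (n := 1)).continuous_deriv le_rfl
  obtain ⟨C, hC⟩ := (isCompact_Icc (a := (0 : ℝ)) (b := 1)).exists_bound_of_continuousOn
    hc.continuousOn
  have hC0 : 0 ≤ C := (norm_nonneg _).trans (hC 0 ⟨le_rfl, zero_le_one⟩)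
  refine ⟨C, hC0, fun x => ?_⟩
  rcases lt_or_ge x 0 with h | h
  · have : deriv Real.smoothTransition x = 0 := by
      have : Real.smoothTransition =ᶠ[𝓝 x] fun _ => 0 := by
        filter_upwards [Iio_mem_nhds h] with y hy
        exact Real.smoothTransition.zero_of_nonpos (le_of_lt hy)
      rw [this.deriv_eq]; simp
    rw [this]; simpa using hC0
  · rcases lt_or_ge 1 x with h' | h'
    · rw [deriv_smoothTransition_of_one_lt h']; simpa using hC0
    · exact hC x ⟨h, h'⟩

lemma contDiff_cutoff (T ε : ℝ) : ContDiff ℝ ∞ (cutoff T ε) := by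
  unfold cutoff
  exact Real.smoothTransition.contDiff.comp (by fun_prop)

lemma hasDerivAt_cutoff (T ε t : ℝ) :
    HasDerivAt (cutoff T ε) (deriv Real.smoothTransition (t * (T - t) / ε - 1) *
      ((T - 2 * t) / ε)) t := by
  have h1 : HasDerivAt Real.smoothTransition
      (deriv Real.smoothTransition (t * (T - t) / ε - 1)) (t * (T - t) / ε - 1) :=
    ((Real.smoothTransition.contDiff (n := 1)).differentiable one_ne_zero _).hasDerivAt
  have h2 : HasDerivAt (fun t : ℝ => t * (T - t) / ε - 1) ((T - 2 * t) / ε) t := by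
    have := (((hasDerivAt_id t).mul ((hasDerivAt_id t).const_sub T)).div_const ε).sub_const 1
    convert! this using 1
    simp; ring
  exact h1.comp t h2

/-- The shift by `-1` makes the cutoff vanish where `t (T - t) ≤ ε`, so its closed support stays
away from both ends. -/
lemma tsupport_cutoff_subset {T ε : ℝ} (hT : 0 < T) (hε : 0 < ε) : tsupport (cutoff T ε) ⊆ Ioo 0 T := by
  have hcl : IsClosed {t : ℝ | ε ≤ t * (T - t)} :=
    isClosed_le continuous_const (by fun_prop)
  have h1 : tsupport (cutoff T ε) ⊆ {t : ℝ | ε ≤ t * (T - t)} := by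
    refine closure_minimal (fun t ht => ?_) hcl
    by_contra h
    refine ht (Real.smoothTransition.zero_of_nonpos ?_)
    simp only [mem_ofPred_eq, not_le] at h
    have : t * (T - t) / ε < 1 := (div_lt_one hε).2 h
    linarith
  refine h1.trans fun t ht => ?_
  simp only [mem_ofPred_eq] at ht
  have hp : 0 < t * (T - t) := hε.trans_le ht
  rcases pos_and_pos_or_neg_and_neg_of_mul_pos hp with h | h
  · exact ⟨h.1, by linarith⟩
  · linarith [h.1, h.2]

lemma tendsto_cutoff {T t : ℝ} (ht : t ∈ Ioo 0 T) :
    Tendsto (fun ε => cutoff T ε t) (𝓝[>] 0) (𝓝 1) := by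
  have hp : 0 < t * (T - t) := mul_pos ht.1 (by linarith [ht.2])
  refine tendsto_const_nhds.congr' ?_
  have : ∀ᶠ ε : ℝ in 𝓝[>] 0, ε < t * (T - t) / 2 :=
    (Iio_mem_nhds (by positivity : (0 : ℝ) < t * (T - t) / 2)) |> mem_nhdsWithin_of_mem_nhds
  filter_upwards [this, self_mem_nhdsWithin] with ε h1 h2
  simp only [mem_Ioi] at h2
  refine (Real.smoothTransition.one_of_one_le ?_).symm
  have : 2 ≤ t * (T - t) / ε := by rw [le_div_iff₀ h2]; linarith
  linarith

/-- The cutoff vanishes at both ends. The mean value zero is what allows a constant to be subtracted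
from `G` in the next lemma. -/
lemma integral_deriv_cutoff {T : ℝ} (hT : 0 < T) (ε : ℝ) :
    ∫ t, ((deriv (cutoff T ε) t : ℝ) : ℂ) ∂(timeMeasure T) = 0 := by
  rw [timeMeasure, ← integral_Ioc_eq_integral_Ioo, ← intervalIntegral.integral_of_le hT.le,
    intervalIntegral.integral_ofReal, intervalIntegral.integral_deriv_eq_sub]
  · simp [cutoff]
  · exact fun t _ => (hasDerivAt_cutoff T ε t).differentiableAt
  · exact ((contDiff_cutoff T ε).continuous_deriv (by simp)).intervalIntegrable _ _

/-- The derivative of the cutoff function only sees the boundary values. -/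
lemma tendsto_integral_deriv_cutoff {T : ℝ} (hT : 0 < T) {G : ℝ → ℂ}
    (hG : ContinuousOn G (Icc 0 T)) (hGe : G 0 = G T) :
    Tendsto (fun ε => ∫ t, ((deriv (cutoff T ε) t : ℝ) : ℂ) * G t ∂(timeMeasure T))
      (𝓝[>] 0) (𝓝 0) := by
  obtain ⟨C, hC0, hC⟩ := exists_deriv_smoothTransition_le
  have hGi : Integrable G (timeMeasure T) := (hG.integrableOn_Icc).mono_set Ioo_subset_Icc_self
  rw [Metric.tendsto_nhds]
  intro δ hδ
  -- The final bound is `8 * C * δ'`; the extra `1` makes it strictly less than `δ`, also when `C =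
  -- 0`.
  set δ' := δ / (8 * C + 1) with hδ'
  have hδ'0 : 0 < δ' := by positivity
  obtain ⟨r0, hr0, H0⟩ := Metric.continuousWithinAt_iff.1 (hG 0 ⟨le_rfl, hT.le⟩) δ' hδ'0
  obtain ⟨r1, hr1, H1⟩ := Metric.continuousWithinAt_iff.1 (hG T ⟨hT.le, le_rfl⟩) δ' hδ'0
  have hsmall : ∀ᶠ ε : ℝ in 𝓝[>] 0, 4 * ε / T < min r0 r1 := by
    have : Tendsto (fun ε : ℝ => 4 * ε / T) (𝓝[>] 0) (𝓝 0) := by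
      have : Continuous fun ε : ℝ => 4 * ε / T := by fun_prop
      simpa using (this.tendsto 0).mono_left nhdsWithin_le_nhds
    exact this.eventually (Iio_mem_nhds (lt_min hr0 hr1))
  filter_upwards [hsmall, self_mem_nhdsWithin] with ε h1 hε
  simp only [mem_Ioi] at hε
  rw [dist_zero_right]
  have hdc : Continuous (deriv (cutoff T ε)) := (contDiff_cutoff T ε).continuous_deriv (by simp)
  have hds : HasCompactSupport (deriv (cutoff T ε)) :=
    (hasCompactSupport_of_subset_Ioo (tsupport_cutoff_subset hT hε)).deriv
  have e1 : ∫ t, ((deriv (cutoff T ε) t : ℝ) : ℂ) * G t ∂(timeMeasure T) =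
      ∫ t, ((deriv (cutoff T ε) t : ℝ) : ℂ) * (G t - G 0) ∂(timeMeasure T) := by
    simp only [mul_sub]
    rw [integral_sub (integrable_ofReal_mul hdc hds hGi)
      (integrable_ofReal_mul hdc hds (integrable_const _)), integral_mul_const,
      integral_deriv_cutoff hT ε, zero_mul, sub_zero]
  -- Outside these two boundary layers `t (T - t) > 2ε`, because the larger of `t` and `T - t` is at
  -- least `T / 2`; there the cutoff is locally constant.
  set A : Set ℝ := Ioo 0 T ∩ (Icc 0 (4 * ε / T) ∪ Icc (T - 4 * ε / T) T) with hA
  have hnear : ∀ t ∈ Ioo 0 T, t ∉ A → deriv (cutoff T ε) t = 0 := by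
    intro t ht htA
    have h2 : 4 * ε / T < t ∧ 4 * ε / T < T - t := by
      simp only [hA, mem_inter_iff, ht, true_and, mem_union, mem_Icc, not_or, not_and,
        not_le] at htA
      refine ⟨htA.1 ht.1.le, ?_⟩
      by_contra h
      have := htA.2 (by linarith)
      linarith [ht.2]
    rw [(hasDerivAt_cutoff T ε t).deriv, deriv_smoothTransition_of_one_lt, zero_mul]
    have h3 : 2 * ε < t * (T - t) := by
      have hq : 0 < 4 * ε / T := by positivity
      have hqT : 4 * ε / T * T = 4 * ε := by field_simp
      rcases le_total t (T - t) with hle | hle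
      · have : T / 2 ≤ T - t := by linarith
        nlinarith [ht.1]
      · have : T / 2 ≤ t := by linarith
        nlinarith [ht.1]
    have : 2 < t * (T - t) / ε := by rwa [lt_div_iff₀ hε]
    linarith
  have e2 : ∫ t, ((deriv (cutoff T ε) t : ℝ) : ℂ) * (G t - G 0) ∂(timeMeasure T) =
      ∫ t in A, ((deriv (cutoff T ε) t : ℝ) : ℂ) * (G t - G 0) := by
    rw [timeMeasure]
    refine (setIntegral_eq_of_subset_of_forall_sdiff_eq_zero measurableSet_Ioo inter_subset_left
      fun t ht => ?_)
    rw [hnear t ht.1 ht.2]; simp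
  have hvol : volume.real A ≤ 8 * ε / T := by
    have : volume.real A ≤ volume.real (Icc 0 (4 * ε / T) ∪ Icc (T - 4 * ε / T) T) :=
      measureReal_mono inter_subset_right
        ((measure_union_le _ _).trans_lt (by simp [Real.volume_Icc])).ne
    refine this.trans ((measureReal_union_le _ _).trans ?_)
    rw [Real.volume_real_Icc_of_le (by positivity), Real.volume_real_Icc_of_le
      (by have : 0 < 4 * ε / T := by positivity
          linarith)]
    exact le_of_eq (by ring)
  have hfin : volume A < ⊤ := (measure_mono inter_subset_left).trans_lt (by simp)
  -- The factor `T / ε` is compensated by the length `8ε / T` of the layers. Near the right end `G 0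
  -- = G T` is what makes `G t - G 0` small.
  have hbd : ∀ t ∈ A, ‖((deriv (cutoff T ε) t : ℝ) : ℂ) * (G t - G 0)‖ ≤ C * (T / ε) * δ' := by
    intro t ht
    rw [norm_mul, Complex.norm_real, (hasDerivAt_cutoff T ε t).deriv, Real.norm_eq_abs, abs_mul]
    have hGd : ‖G t - G 0‖ ≤ δ' := by
      have hI : t ∈ Icc 0 T := Ioo_subset_Icc_self ht.1
      rcases ht.2 with h | h
      · have := H0 hI (by
          rw [Real.dist_eq, sub_zero, abs_of_nonneg h.1]
          exact h.2.trans_lt (h1.trans_le (min_le_left _ _)))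
        rw [dist_eq_norm] at this
        exact this.le
      · have := H1 hI (by
          rw [Real.dist_eq, abs_sub_comm, abs_of_nonneg (by linarith [h.2])]
          refine lt_of_le_of_lt ?_ (h1.trans_le (min_le_right _ _))
          linarith [h.1])
        rw [dist_eq_norm, ← hGe] at this
        exact this.le
    have h2 : |(T - 2 * t) / ε| ≤ T / ε := by
      rw [abs_div, abs_of_pos hε]
      gcongr
      rw [abs_le]; constructor <;> linarith [ht.1.1, ht.1.2]
    gcongr
    exact hC _
  rw [e1, e2]
  refine (norm_setIntegral_le_of_norm_le_const hfin hbd).trans_lt ?_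
  calc C * (T / ε) * δ' * volume.real A ≤ C * (T / ε) * δ' * (8 * ε / T) := by gcongr
    _ = 8 * C * δ' := by field_simp
    _ < (8 * C + 1) * δ' := by linarith
    _ = δ := by rw [hδ']; field_simp

/-- The Fourier coefficients of the weak derivative of a periodic function. -/
lemma coeff_weakDeriv {T : ℝ} (hT : 0 < T) {y y' Y : ℝ → ℂ} (hw : IsWeakDeriv T y y')
    (hy : Integrable y (timeMeasure T)) (hy' : Integrable y' (timeMeasure T))
    (hY : ContinuousOn Y (Icc 0 T)) (hYe : Y 0 = Y T) (hyY : y =ᵐ[timeMeasure T] Y) (k : ℤ) :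
    coeff T k y' = (freq T k : ℂ) * Complex.I * coeff T k y := by
  have hwc : ContDiff ℝ ∞ (wave T (-k)) := by
    unfold wave
    exact contDiff_const.mul (Complex.contDiff_exp.comp
      ((Complex.ofRealCLM.contDiff.comp (contDiff_const.mul contDiff_id)).mul contDiff_const))
  have hlim : ∀ {x : ℝ → ℂ}, Integrable x (timeMeasure T) →
      Tendsto (fun ε => ∫ t, (cutoff T ε t : ℂ) * (wave T (-k) t * x t) ∂(timeMeasure T))
        (𝓝[>] 0) (𝓝 (coeff T k x)) := by
    intro x hx
    have hi := integrable_conj_wave_smul k hx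
    simp only [conj_wave, smul_eq_mul] at hi
    have e : coeff T k x = ∫ t, wave T (-k) t * x t ∂(timeMeasure T) := by
      simp only [coeff, conj_wave, smul_eq_mul]
    rw [e]
    refine tendsto_integral_filter_of_dominated_convergence
      (fun t => ‖wave T (-k) t * x t‖) (Eventually.of_forall fun ε => ?_)
      (Eventually.of_forall fun ε => ae_of_all _ fun t => ?_) hi.norm ?_
    · exact (Complex.continuous_ofReal.comp
        (contDiff_cutoff T ε).continuous).aestronglyMeasurable.mul hi.aestronglyMeasurable
    · rw [norm_mul, Complex.norm_real, Real.norm_eq_abs,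
        abs_of_nonneg (show 0 ≤ cutoff T ε t from Real.smoothTransition.nonneg _)]
      exact mul_le_of_le_one_left (norm_nonneg _) (Real.smoothTransition.le_one _)
    · rw [timeMeasure]
      filter_upwards [ae_restrict_mem measurableSet_Ioo] with t ht
      have := ((Complex.continuous_ofReal.tendsto 1).comp (tendsto_cutoff ht)).mul_const
        (wave T (-k) t * x t)
      simpa using this
  have hG := tendsto_integral_deriv_cutoff hT (G := fun t => wave T (-k) t * Y t)
    ((continuous_wave T (-k)).continuousOn.mul hY) (by simp only [hYe, wave_end hT])
  -- The weak derivative is tested with the cutoff times the conjugate wave. In the term containing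
  -- the derivative of the cutoff, `y` is replaced by its continuous representative, so that this
  -- term tends to zero by `hG`.
  have hid : ∀ᶠ ε in 𝓝[>] (0 : ℝ),
      -∫ t, ((deriv (cutoff T ε) t : ℝ) : ℂ) * (wave T (-k) t * Y t) ∂(timeMeasure T) =
      ∫ t, (cutoff T ε t : ℂ) * (wave T (-k) t * y' t) ∂(timeMeasure T) -
      (freq T k : ℂ) * Complex.I *
        ∫ t, (cutoff T ε t : ℂ) * (wave T (-k) t * y t) ∂(timeMeasure T) := by
    filter_upwards [self_mem_nhdsWithin] with ε hε
    simp only [mem_Ioi] at hε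
    have hcs := hasCompactSupport_of_subset_Ioo (tsupport_cutoff_subset hT hε)
    have hz : ContDiff ℝ ∞ fun t => (cutoff T ε t : ℂ) * wave T (-k) t :=
      (Complex.ofRealCLM.contDiff.comp (contDiff_cutoff T ε)).mul hwc
    have hzs : tsupport (fun t => (cutoff T ε t : ℂ) * wave T (-k) t) ⊆ Ioo 0 T := by
      refine (closure_mono fun t ht => ?_).trans (tsupport_cutoff_subset hT hε)
      simp only [Function.mem_support] at ht ⊢
      exact fun h => ht (by simp [h])
    have hdz : ∀ t, deriv (fun t => (cutoff T ε t : ℂ) * wave T (-k) t) t =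
        ((deriv (cutoff T ε) t : ℝ) : ℂ) * wave T (-k) t +
          (-((freq T k : ℂ) * Complex.I)) * ((cutoff T ε t : ℂ) * wave T (-k) t) := by
      intro t
      have h1 := (hasDerivAt_cutoff T ε t).differentiableAt.hasDerivAt.ofReal_comp
      refine (h1.mul (hasDerivAt_wave T (-k) t)).deriv.trans ?_
      rw [freq_neg]
      push_cast; ring
    have := hw.complex hy hy' hz hzs
    simp only [hdz] at this
    have hyw := integrable_conj_wave_smul k hy
    simp only [conj_wave, smul_eq_mul] at hyw
    have i1 := integrable_ofReal_mul ((contDiff_cutoff T ε).continuous_deriv (by simp))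
      hcs.deriv hyw
    have i2 := integrable_ofReal_mul (contDiff_cutoff T ε).continuous hcs hyw
    have e3 : ∫ t, ((deriv (cutoff T ε) t : ℝ) : ℂ) * (wave T (-k) t * Y t) ∂(timeMeasure T) =
        ∫ t, ((deriv (cutoff T ε) t : ℝ) : ℂ) * (wave T (-k) t * y t) ∂(timeMeasure T) :=
      integral_congr_ae (by filter_upwards [hyY] with t ht; rw [ht])
    have e4 : ∫ t, (((deriv (cutoff T ε) t : ℝ) : ℂ) * wave T (-k) t +
          (-((freq T k : ℂ) * Complex.I)) * ((cutoff T ε t : ℂ) * wave T (-k) t)) * y t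
          ∂(timeMeasure T) =
        ∫ t, ((deriv (cutoff T ε) t : ℝ) : ℂ) * (wave T (-k) t * y t) ∂(timeMeasure T) +
        (-((freq T k : ℂ) * Complex.I)) *
          ∫ t, (cutoff T ε t : ℂ) * (wave T (-k) t * y t) ∂(timeMeasure T) := by
      rw [← integral_const_mul, ← integral_add i1 (i2.const_mul _)]
      refine integral_congr_ae (ae_of_all _ fun t => ?_)
      ring
    rw [e3]
    rw [e4] at this
    simp only [mul_assoc] at this ⊢
    linear_combination -this
  have hl := ((hlim hy').sub ((hlim hy).const_mul ((freq T k : ℂ) * Complex.I))).congr'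
    (hid.mono fun _ h => h.symm)
  have := tendsto_nhds_unique hl hG.neg
  rw [neg_zero] at this
  exact sub_eq_zero.1 this

/-- A square integrable function whose Fourier coefficients are those of a derivative. -/
lemma isWeakDeriv_of_coeff {T : ℝ} (hT : 0 < T) {y y' : ℝ → ℂ} (hy : MemLp y 2 (timeMeasure T))
    (hy' : MemLp y' 2 (timeMeasure T))
    (h : ∀ k, coeff T k y' = (freq T k : ℂ) * Complex.I * coeff T k y) : IsWeakDeriv T y y' := by
  intro η hη hc hs
  have hdc := hη.continuous_deriv (by simp)
  have hmem : ∀ {θ : ℝ → ℝ}, Continuous θ → HasCompactSupport θ →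
      MemLp (fun t => (θ t : ℂ)) 2 (timeMeasure T) := by
    intro θ h1 h2
    obtain ⟨C, hC⟩ := h2.exists_bound_of_continuous h1
    exact MemLp.of_bound (Complex.continuous_ofReal.comp h1).aestronglyMeasurable C
      (ae_of_all _ fun t => by simpa using hC t)
  have hpars : ∀ {θ : ℝ → ℝ} {x : ℝ → ℂ}, MemLp (fun t => (θ t : ℂ)) 2 (timeMeasure T) →
      MemLp x 2 (timeMeasure T) →
      HasSum (fun k => starRingEnd ℂ (coeff T k fun t => (θ t : ℂ)) * coeff T k x)
        (∫ t, (θ t : ℂ) * x t ∂(timeMeasure T)) := by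
    intro θ x h1 h2
    have := hasSum_inner_coeff hT (h1.toLp _) (h2.toLp _)
    simp only [coeff_toLp, RCLike.inner_apply', L2.inner_def] at this
    convert! this using 1
    refine integral_congr_ae ?_
    filter_upwards [h1.coeFn_toLp, h2.coeFn_toLp] with t e1 e2
    rw [e1, e2]; simp
  -- Classical integration by parts; the boundary terms vanish with `η`.
  have hηk : ∀ k, coeff T k (fun t => ((deriv η t : ℝ) : ℂ)) =
      (freq T k : ℂ) * Complex.I * coeff T k fun t => (η t : ℂ) := by
    intro k
    have hη0 : η 0 = 0 := image_eq_zero_of_notMem_tsupport fun h => lt_irrefl _ (hs h).1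
    have hηT : η T = 0 := image_eq_zero_of_notMem_tsupport fun h => lt_irrefl _ (hs h).2
    simp only [coeff, conj_wave, timeMeasure, smul_eq_mul]
    rw [← integral_Ioc_eq_integral_Ioo, ← integral_Ioc_eq_integral_Ioo,
      ← intervalIntegral.integral_of_le hT.le, ← intervalIntegral.integral_of_le hT.le,
      intervalIntegral.integral_mul_deriv_eq_deriv_mul
        (fun t _ => hasDerivAt_wave T (-k) t)
        (fun t _ => ((hη.differentiable (by simp) t).hasDerivAt).ofReal_comp), hη0, hηT,
      ← intervalIntegral.integral_const_mul, freq_neg]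
    · simp only [Complex.ofReal_zero, mul_zero, sub_zero, zero_sub]
      rw [← intervalIntegral.integral_neg]
      congr 1
      ext t
      push_cast; ring
    · exact ((continuous_wave T (-k)).const_mul _).intervalIntegrable _ _
    · exact (Complex.continuous_ofReal.comp hdc).intervalIntegrable _ _
  -- Both sides become Parseval sums, and conjugating `iτ` supplies the minus sign.
  have s1 := hpars (hmem hdc hc.deriv) hy
  have s2 := (hpars (hmem hη.continuous hc) hy').neg
  refine s1.unique ?_
  convert! s2 using 2 with k
  rw [hηk, h]
  simp only [map_mul, Complex.conj_ofReal, Complex.conj_I]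
  ring

/-! ### Bounded multipliers on `L²` -/

/-- Multiplication by an essentially bounded function, on `L²(ℝ)`. -/
def mulOp (a : ℝ → ℂ) (ha : MemLp a ∞ volume) : L2 →L[ℂ] L2 :=
  (ContinuousLinearMap.mul ℂ ℂ).holderL volume ∞ 2 2 (ha.toLp a)

lemma coeFn_mulOp {a : ℝ → ℂ} (ha : MemLp a ∞ volume) (h : L2) :
    mulOp a ha h =ᵐ[volume] fun ξ => a ξ * h ξ := by
  have := (ContinuousLinearMap.mul ℂ ℂ).coeFn_holder (r := 2) (ha.toLp a) h
  filter_upwards [this, ha.coeFn_toLp] with ξ h1 h2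
  rw [← h2]
  exact h1

/-- For unbounded `m` the relation `g = m h` is divided by `1 + |m|`. Both sides are then bounded
operators on `L²`, which commute with integrals over time. -/
lemma memLp_top_inv_one_add {m : ℝ → ℂ} (hm : Measurable m) :
    MemLp (fun ξ => ((1 + ‖m ξ‖ : ℝ) : ℂ)⁻¹) ∞ volume := by
  refine memLp_top_of_bound (C := 1) (by fun_prop) (ae_of_all _ fun ξ => ?_)
  rw [norm_inv, Complex.norm_real, Real.norm_eq_abs, abs_of_nonneg (by positivity)]
  exact inv_le_one_of_one_le₀ (by linarith [norm_nonneg (m ξ)])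

lemma memLp_top_div_one_add {m : ℝ → ℂ} (hm : Measurable m) :
    MemLp (fun ξ => m ξ * ((1 + ‖m ξ‖ : ℝ) : ℂ)⁻¹) ∞ volume := by
  refine memLp_top_of_bound (C := 1) (by fun_prop) (ae_of_all _ fun ξ => ?_)
  rw [norm_mul, norm_inv, Complex.norm_real, Real.norm_eq_abs, abs_of_nonneg (by positivity),
    ← div_eq_mul_inv]
  exact div_le_one_of_le₀ (by linarith) (by positivity)

/-- The relation `g = m h` in `L²` in terms of bounded operators. -/
lemma ae_eq_mul_iff {m : ℝ → ℂ} (hm : Measurable m) (g h : L2) :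
    (g =ᵐ[volume] fun ξ => m ξ * h ξ) ↔
      mulOp _ (memLp_top_inv_one_add hm) g = mulOp _ (memLp_top_div_one_add hm) h := by
  have h1 := coeFn_mulOp (memLp_top_inv_one_add hm) g
  have h2 := coeFn_mulOp (memLp_top_div_one_add hm) h
  constructor
  · intro H
    refine Lp.ext ?_
    filter_upwards [H, h1, h2] with ξ e e1 e2
    rw [e1, e2, e]
    ring
  · intro H
    rw [← H] at h2
    filter_upwards [h1, h2] with ξ e1 e2
    have hne : ((1 + ‖m ξ‖ : ℝ) : ℂ) ≠ 0 := by
      have : (0 : ℝ) < 1 + ‖m ξ‖ := by positivity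
      exact_mod_cast this.ne'
    rw [e1] at e2
    field_simp at e2
    linear_combination e2

lemma coeff_mul {T : ℝ} {m : ℝ → ℂ} (hm : Measurable m) {F G : ℝ → L2}
    (hF : Integrable F (timeMeasure T)) (hG : Integrable G (timeMeasure T))
    (h : ∀ᵐ t ∂(timeMeasure T), G t =ᵐ[volume] fun ξ => m ξ * F t ξ) (k : ℤ) :
    (coeff T k G : L2) =ᵐ[volume] fun ξ => m ξ * coeff T k F ξ := by
  rw [ae_eq_mul_iff hm, ← coeff_clm k _ hF, ← coeff_clm k _ hG]
  refine coeff_congr k ?_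
  filter_upwards [h] with t ht
  exact (ae_eq_mul_iff hm _ _).1 ht

lemma memLp_clm_comp {T : ℝ} (B : L2 →L[ℂ] L2) {F : ℝ → L2} (hF : MemLp F 2 (timeMeasure T)) :
    MemLp (fun t => B (F t)) 2 (timeMeasure T) :=
  B.comp_memLp' hF

lemma ae_eq_mul_of_coeff {T : ℝ} (hT : 0 < T) {m : ℝ → ℂ} (hm : Measurable m) {F G : ℝ → L2}
    (hF : MemLp F 2 (timeMeasure T)) (hG : MemLp G 2 (timeMeasure T))
    (h : ∀ k, (coeff T k G : L2) =ᵐ[volume] fun ξ => m ξ * coeff T k F ξ) :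
    ∀ᵐ t ∂(timeMeasure T), G t =ᵐ[volume] fun ξ => m ξ * F t ξ := by
  have : Fact ((2 : ℝ≥0∞) ≠ ⊤) := ⟨by norm_num⟩
  simp only [ae_eq_mul_iff hm] at h ⊢
  refine ae_eq_of_coeff_eq hT (memLp_clm_comp _ hG) (memLp_clm_comp _ hF) fun k => ?_
  rw [coeff_clm k _ (hG.integrable one_le_two), coeff_clm k _ (hF.integrable one_le_two), h]

/-! ### Distributions whose Fourier transform is a function -/

/-- Test with a bump function equal to `1` on a ball containing the given compact set. -/
lemma integral_schwartz_mul_locallyIntegrable {h : ℝ → ℂ}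
    (hi : ∀ φ : 𝓢(ℝ, ℂ), Integrable fun ξ => φ ξ * h ξ) : LocallyIntegrable h := by
  rw [locallyIntegrable_iff]
  intro K hK
  obtain ⟨R, hR⟩ := hK.isBounded.subset_closedBall 0
  let b : ContDiffBump (0 : ℝ) := ⟨max R 1, max R 1 + 1, by positivity, by linarith⟩
  have hb1 : HasCompactSupport (Complex.ofRealCLM ∘ b) := b.hasCompactSupport.comp_left rfl
  have hb2 : ContDiff ℝ ∞ (Complex.ofRealCLM ∘ b) := Complex.ofRealCLM.contDiff.comp b.contDiff
  refine (hi (hb1.toSchwartzMap hb2)).integrableOn.congr_fun (s := K) (fun ξ hξ => ?_)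
    hK.measurableSet
  have : b ξ = 1 := b.one_of_mem_closedBall
    (Metric.closedBall_subset_closedBall (le_max_left _ _) (hR hξ))
  simp [this]

lemma ae_eq_of_forall_schwartz {g h : ℝ → ℂ} (hg : ∀ φ : 𝓢(ℝ, ℂ), Integrable fun ξ => φ ξ * g ξ)
    (hh : ∀ φ : 𝓢(ℝ, ℂ), Integrable fun ξ => φ ξ * h ξ)
    (he : ∀ φ : 𝓢(ℝ, ℂ), ∫ ξ, φ ξ * g ξ = ∫ ξ, φ ξ * h ξ) : g =ᵐ[volume] h := by
  refine ae_eq_of_integral_contDiff_smul_eq (integral_schwartz_mul_locallyIntegrable hg)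
    (integral_schwartz_mul_locallyIntegrable hh) fun b hb1 hb2 => ?_
  have h1 : HasCompactSupport (Complex.ofRealCLM ∘ b) := hb2.comp_left rfl
  have h2 : ContDiff ℝ ∞ (Complex.ofRealCLM ∘ b) := Complex.ofRealCLM.contDiff.comp hb1
  simpa using he (h1.toSchwartzMap h2)

lemma IsFourierFun.unique {v : 𝓢'(ℝ, ℂ)} {g h : ℝ → ℂ} (hg : IsFourierFun v g)
    (hh : IsFourierFun v h) : g =ᵐ[volume] h :=
  ae_eq_of_forall_schwartz (fun φ => (hg φ).1) (fun φ => (hh φ).1)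
    fun φ => (hg φ).2.symm.trans (hh φ).2

lemma IsFourierFun.congr {v : 𝓢'(ℝ, ℂ)} {g h : ℝ → ℂ} (hg : IsFourierFun v g)
    (e : g =ᵐ[volume] h) : IsFourierFun v h := by
  intro φ
  have : (fun ξ => φ ξ * g ξ) =ᵐ[volume] fun ξ => φ ξ * h ξ := by
    filter_upwards [e] with ξ hξ
    rw [hξ]
  exact ⟨(hg φ).1.congr this, (hg φ).2.trans (integral_congr_ae this)⟩

lemma IsFourierFun.eq {v w : 𝓢'(ℝ, ℂ)} {h : ℝ → ℂ} (hv : IsFourierFun v h)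
    (hw : IsFourierFun w h) : v = w := by
  have : 𝓕 v = 𝓕 w := by
    ext φ
    rw [(hv φ).2, (hw φ).2]
  rw [← FourierTransform.fourierInv_fourier_eq (F := 𝓢'(ℝ, ℂ)) v, this,
    FourierTransform.fourierInv_fourier_eq]

lemma IsFourierFun.apply_fourier {v : 𝓢'(ℝ, ℂ)} {h : ℝ → ℂ} (hv : IsFourierFun v h)
    (φ : 𝓢(ℝ, ℂ)) : v (𝓕 φ) = ∫ ξ, φ ξ * h ξ := (hv φ).2

lemma IsFourierFun.apply {v : 𝓢'(ℝ, ℂ)} {h : ℝ → ℂ} (hv : IsFourierFun v h)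
    (φ : 𝓢(ℝ, ℂ)) : v φ = ∫ ξ, (𝓕⁻ φ) ξ * h ξ := by
  rw [← hv.apply_fourier, FourierTransform.fourier_fourierInv_eq]

lemma IsFourierFun.add {v w : 𝓢'(ℝ, ℂ)} {g h : ℝ → ℂ} (hv : IsFourierFun v g)
    (hw : IsFourierFun w h) : IsFourierFun (v + w) (fun ξ => g ξ + h ξ) := by
  intro φ
  simp only [mul_add]
  refine ⟨(hv φ).1.add (hw φ).1, ?_⟩
  rw [integral_add (hv φ).1 (hw φ).1, ← (hv φ).2, ← (hw φ).2]
  rfl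

lemma IsFourierFun.smul {v : 𝓢'(ℝ, ℂ)} {g : ℝ → ℂ} (hv : IsFourierFun v g) (c : ℂ) :
    IsFourierFun (c • v) (fun ξ => c * g ξ) := by
  intro φ
  simp only [mul_left_comm _ c]
  refine ⟨(hv φ).1.const_mul c, ?_⟩
  rw [integral_const_mul, ← (hv φ).2]
  rfl

lemma integrable_schwartz_mul (φ : 𝓢(ℝ, ℂ)) (h : L2) : Integrable fun ξ => φ ξ * h ξ :=
  (φ.memLp 2).integrable_mul (Lp.memLp h)

lemma isFourierFun_coe (g : L2) : IsFourierFun (g : 𝓢'(ℝ, ℂ)) (𝓕 g : L2) := by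
  intro φ
  refine ⟨integrable_schwartz_mul φ _, ?_⟩
  rw [Lp.fourier_toTemperedDistribution_eq, Lp.toTemperedDistribution_apply]
  rfl

/-- The square integrable function `h`, on the frequency side, as a distribution. -/
def ofFourier (h : L2) : 𝓢'(ℝ, ℂ) := ((𝓕⁻ h : L2) : 𝓢'(ℝ, ℂ))

lemma isFourierFun_ofFourier (h : L2) : IsFourierFun (ofFourier h) h := by
  have := isFourierFun_coe (𝓕⁻ h)
  rwa [FourierTransform.fourier_fourierInv_eq] at this

/-- The Fourier transform of `v` is a function, whose product with the symbol `m` is `G`. -/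
def IsFourierLift (m : ℝ → ℝ) (v : 𝓢'(ℝ, ℂ)) (G : L2) : Prop :=
  ∃ h : ℝ → ℂ, IsFourierFun v h ∧ G =ᵐ[volume] fun ξ => (m ξ : ℂ) * h ξ

lemma sobolevLift_iff {m : ℝ → ℝ} {v : 𝓢'(ℝ, ℂ)} {g : L2} :
    SobolevLift m v g ↔ IsFourierLift m v (𝓕 g) := by
  constructor
  · rintro ⟨h, h1, h2⟩
    exact ⟨h, h1, (isFourierFun_coe g).unique h2⟩
  · rintro ⟨h, h1, h2⟩
    exact ⟨h, h1, (isFourierFun_coe g).congr h2⟩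

lemma IsFourierLift.ae_eq {m : ℝ → ℝ} {v : 𝓢'(ℝ, ℂ)} {G : L2} {h : ℝ → ℂ}
    (hG : IsFourierLift m v G) (hh : IsFourierFun v h) :
    G =ᵐ[volume] fun ξ => (m ξ : ℂ) * h ξ := by
  obtain ⟨h', h1, h2⟩ := hG
  filter_upwards [h1.unique hh, h2] with ξ e1 e2
  rw [e2, e1]

lemma IsFourierLift.unique {m : ℝ → ℝ} {v : 𝓢'(ℝ, ℂ)} {G G' : L2}
    (hG : IsFourierLift m v G) (hG' : IsFourierLift m v G') : G = G' := by
  obtain ⟨h, h1, h2⟩ := hG'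
  exact Lp.ext ((hG.ae_eq h1).trans h2.symm)

lemma sobolevLift_fourierInv {m : ℝ → ℝ} {v : 𝓢'(ℝ, ℂ)} {G : L2} (h : IsFourierLift m v G) :
    SobolevLift m v (𝓕⁻ G) := by
  rw [sobolevLift_iff, FourierTransform.fourier_fourierInv_eq]
  exact h

lemma norm_fourierInv (G : L2) : ‖(𝓕⁻ G : L2)‖ = ‖G‖ := by
  conv_rhs => rw [← FourierTransform.fourier_fourierInv_eq (F := L2) G]
  exact (Lp.norm_fourier_eq _).symm

/-! ### Norms in terms of the frequency side -/

/-- The lift of `u t` is unique, so all competitors in the infimum have almost everywhere the same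
norm, which Plancherel carries to the frequency side. -/
lemma normL2_eq {T : ℝ} {m : ℝ → ℝ} {u : ℝ → 𝓢'(ℝ, ℂ)} {G : ℝ → L2}
    (hG : AEStronglyMeasurable G (timeMeasure T))
    (h : ∀ᵐ t ∂(timeMeasure T), IsFourierLift m (u t) (G t)) :
    normL2 T m u = eLpNorm G 2 (timeMeasure T) := by
  apply le_antisymm
  · have hc : AEStronglyMeasurable (fun t => (𝓕⁻ (G t) : L2)) (timeMeasure T) :=
      (ContinuousFourierInv.continuous_fourierInv (E := L2)).comp_aestronglyMeasurable hG
    refine (iInf₂_le (fun t => (𝓕⁻ (G t) : L2)) ⟨hc, ?_⟩).trans (le_of_eq ?_)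
    · exact eLpNorm_congr_norm_ae (ae_of_all _ fun t => norm_fourierInv _)
    · filter_upwards [h] with t ht
      exact sobolevLift_fourierInv ht
  · refine le_iInf₂ fun g hg => le_of_eq ?_
    refine eLpNorm_congr_norm_ae ?_
    filter_upwards [h, hg.2] with t h1 h2
    rw [sobolevLift_iff] at h2
    rw [h1.unique h2, Lp.norm_fourier_eq]

lemma exists_lift_of_normL2_lt_top {T : ℝ} {m : ℝ → ℝ} {u : ℝ → 𝓢'(ℝ, ℂ)}
    (h : normL2 T m u < ⊤) : ∃ G : ℝ → L2, MemLp G 2 (timeMeasure T) ∧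
      ∀ᵐ t ∂(timeMeasure T), IsFourierLift m (u t) (G t) := by
  simp only [normL2, iInf_lt_iff] at h
  obtain ⟨g, ⟨h1, h2⟩, h3⟩ := h
  refine ⟨fun t => 𝓕 (g t), ⟨?_, ?_⟩, ?_⟩
  · exact (ContinuousFourier.continuous_fourier (E := L2)).comp_aestronglyMeasurable h1
  · rw [eLpNorm_congr_norm_ae (g := g) (ae_of_all _ fun t => Lp.norm_fourier_eq _)]
    exact h3
  · filter_upwards [h2] with t ht
    exact sobolevLift_iff.1 ht

/-! ### Testing distributions through their lifts. -/

/-- Pairing with a square integrable function. -/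
def pairL {ψ : ℝ → ℂ} (hψ : MemLp ψ 2 volume) : L2 →L[ℂ] ℂ :=
  innerSL ℂ (hψ.star.toLp _)

lemma pairL_apply {ψ : ℝ → ℂ} (hψ : MemLp ψ 2 volume) (h : L2) :
    pairL hψ h = ∫ ξ, ψ ξ * h ξ := by
  rw [pairL, innerSL_apply_apply, L2.inner_def]
  refine integral_congr_ae ?_
  filter_upwards [hψ.star.coeFn_toLp] with ξ hξ
  rw [hξ, RCLike.inner_apply']
  simp

/-- The reciprocal of `m` grows at most linearly. -/
def InvLinearGrowth (m : ℝ → ℝ) : Prop :=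
  Measurable m ∧ (∀ᵐ ξ, m ξ ≠ 0) ∧ ∃ C, 0 ≤ C ∧ ∀ ξ, |m ξ|⁻¹ ≤ C * (1 + |ξ|)

/-- Schwartz decay absorbs the growth of `1/m`. Hence testing a distribution is a continuous
functional of its lift, which commutes with time integrals. -/
lemma InvLinearGrowth.memLp {m : ℝ → ℝ} (hm : InvLinearGrowth m) (φ : 𝓢(ℝ, ℂ)) :
    MemLp (fun ξ => φ ξ * (m ξ : ℂ)⁻¹) 2 volume := by
  obtain ⟨h1, -, C, hC, h2⟩ := hm
  have hms : AEStronglyMeasurable (fun ξ => φ ξ * (m ξ : ℂ)⁻¹) volume :=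
    φ.continuous.aestronglyMeasurable.mul
      (Complex.measurable_ofReal.comp h1).inv.aestronglyMeasurable
  refine (memLp_two_iff_integrable_sq_norm hms).2 ?_
  obtain ⟨M, hM⟩ : ∃ M, ∀ ξ, ‖φ ξ‖ ≤ M :=
    ⟨_, fun ξ => SchwartzMap.norm_le_seminorm ℝ φ ξ⟩
  have hM0 : 0 ≤ M := (norm_nonneg _).trans (hM 0)
  -- From `‖φ‖² ≤ M ‖φ‖` and `(1 + |ξ|)² ≤ 2 (1 + |ξ|²)`, which leave only the moments of order `0`
  -- and `2`.
  have hi : Integrable fun ξ : ℝ => (2 * C ^ 2 * M) * (‖ξ‖ ^ 0 * ‖φ ξ‖ + ‖ξ‖ ^ 2 * ‖φ ξ‖) :=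
    ((φ.integrable_pow_mul volume 0).add (φ.integrable_pow_mul volume 2)).const_mul _
  refine hi.mono' (hms.norm.pow 2) (ae_of_all _ fun ξ => ?_)
  rw [Real.norm_eq_abs, abs_of_nonneg (by positivity), norm_mul, norm_inv, Complex.norm_real,
    Real.norm_eq_abs, mul_pow, pow_zero, one_mul]
  have e1 : (|m ξ|⁻¹) ^ 2 ≤ (C * (1 + |ξ|)) ^ 2 := by
    gcongr
    exact h2 ξ
  have e2 : ‖φ ξ‖ ^ 2 ≤ M * ‖φ ξ‖ := by
    rw [sq]; gcongr; exact hM ξ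
  calc ‖φ ξ‖ ^ 2 * |m ξ|⁻¹ ^ 2 ≤ (M * ‖φ ξ‖) * (C * (1 + |ξ|)) ^ 2 := by gcongr
    _ ≤ (M * ‖φ ξ‖) * (C ^ 2 * (2 * (1 + |ξ| ^ 2))) := by
        rw [mul_pow]
        gcongr
        nlinarith [sq_nonneg (1 - |ξ|)]
    _ = _ := by rw [Real.norm_eq_abs]; ring

/-- Testing a distribution, in terms of its lift. -/
lemma IsFourierLift.apply_fourier {m : ℝ → ℝ} (hm : InvLinearGrowth m) {v : 𝓢'(ℝ, ℂ)} {G : L2}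
    (hG : IsFourierLift m v G) (φ : 𝓢(ℝ, ℂ)) : v (𝓕 φ) = pairL (hm.memLp φ) G := by
  obtain ⟨h, h1, h2⟩ := hG
  rw [h1.apply_fourier, pairL_apply]
  refine integral_congr_ae ?_
  filter_upwards [h2, hm.2.1] with ξ e1 e2
  have : (m ξ : ℂ) ≠ 0 := by exact_mod_cast e2
  rw [e1]
  field_simp

lemma EqAtEndpoints.exists_continuous {T : ℝ} {m : ℝ → ℝ} {v : ℝ → 𝓢'(ℝ, ℂ)} (hT : 0 < T)
    (h : EqAtEndpoints T m v) : ∃ g : ℝ → L2, ContinuousOn g (Icc 0 T) ∧ g 0 = g T ∧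
      ∀ᵐ t ∂(timeMeasure T), IsFourierLift m (v t) (g t) := by
  obtain ⟨U, h1, ⟨g, h2, h3⟩, h4⟩ := h
  refine ⟨fun t => 𝓕 (g t),
    (ContinuousFourier.continuous_fourier (E := L2)).comp_continuousOn h2, ?_, ?_⟩
  · have e0 := sobolevLift_iff.1 (h3 0 ⟨le_rfl, hT.le⟩)
    have e1 := sobolevLift_iff.1 (h3 T ⟨hT.le, le_rfl⟩)
    rw [h4] at e0
    exact e0.unique e1
  · have := ae_restrict_mem (μ := volume) (measurableSet_Ioo (a := (0 : ℝ)) (b := T))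
    filter_upwards [h1, this] with t e1 e2
    rw [e1]
    exact sobolevLift_iff.1 (h3 t (Ioo_subset_Icc_self e2))

/-- The Fourier coefficients of the weak time derivative of a periodic map. -/
lemma coeff_timeDeriv {T : ℝ} (hT : 0 < T) {v v' : ℝ → 𝓢'(ℝ, ℂ)} {G G' : ℝ → L2} {m m' : ℝ → ℝ}
    (hm : InvLinearGrowth m) (hm' : InvLinearGrowth m') (hv : IsTimeDeriv T v v')
    (hG : MemLp G 2 (timeMeasure T)) (hG' : MemLp G' 2 (timeMeasure T))
    (hvG : ∀ᵐ t ∂(timeMeasure T), IsFourierLift m (v t) (G t))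
    (hvG' : ∀ᵐ t ∂(timeMeasure T), IsFourierLift m' (v' t) (G' t))
    (hper : EqAtEndpoints T m v) (k : ℤ) :
    ∀ᵐ ξ, (m' ξ : ℂ)⁻¹ * coeff T k G' ξ =
      (freq T k : ℂ) * Complex.I * ((m ξ : ℂ)⁻¹ * coeff T k G ξ) := by
  obtain ⟨g, hg1, hg2, hg3⟩ := hper.exists_continuous hT
  have hi : ∀ {n : ℝ → ℝ} (hn : InvLinearGrowth n) (φ : 𝓢(ℝ, ℂ)) (h : L2),
      Integrable fun ξ => φ ξ * ((n ξ : ℂ)⁻¹ * h ξ) := by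
    intro n hn φ h
    simp only [← mul_assoc]
    exact (hn.memLp φ).integrable_mul (Lp.memLp h)
  refine ae_eq_of_forall_schwartz (hi hm' · _) (fun φ => ?_) fun φ => ?_
  · have := (hi hm φ (coeff T k G)).const_mul ((freq T k : ℂ) * Complex.I)
    refine this.congr (ae_of_all _ fun ξ => ?_)
    ring
  · have hy : (fun t => v t (𝓕 φ)) =ᵐ[timeMeasure T] fun t => pairL (hm.memLp φ) (G t) := by
      filter_upwards [hvG] with t ht
      exact ht.apply_fourier hm φ
    have hy' : (fun t => v' t (𝓕 φ)) =ᵐ[timeMeasure T] fun t => pairL (hm'.memLp φ) (G' t) := by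
      filter_upwards [hvG'] with t ht
      exact ht.apply_fourier hm' φ
    have hyg : (fun t => v t (𝓕 φ)) =ᵐ[timeMeasure T] fun t => pairL (hm.memLp φ) (g t) := by
      filter_upwards [hg3] with t ht
      exact ht.apply_fourier hm φ
    -- For each fixed test function the claim is the scalar `coeff_weakDeriv`; pairing with the
    -- continuous lift `g` gives the continuous representative with equal end values.
    obtain ⟨i1, i2, hw⟩ := hv (𝓕 φ)
    have key := coeff_weakDeriv hT (y := fun t => v t (𝓕 φ)) (y' := fun t => v' t (𝓕 φ)) hw i1 i2
      ((pairL (hm.memLp φ)).continuous.comp_continuousOn hg1) (congrArg (pairL (hm.memLp φ)) hg2) hyg k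
    rw [coeff_congr k hy, coeff_congr k hy', coeff_clm k _ (hG.integrable one_le_two),
      coeff_clm k _ (hG'.integrable one_le_two), pairL_apply, pairL_apply,
      ← integral_const_mul] at key
    simp only [← mul_assoc] at key ⊢
    rw [key]
    congr 1
    ext ξ
    ring

/-- Weak time derivatives from Fourier coefficients. -/
lemma isTimeDeriv_of_coeff {T : ℝ} (hT : 0 < T) {G G' : ℝ → L2}
    (hG : MemLp G 2 (timeMeasure T)) (hG' : MemLp G' 2 (timeMeasure T))
    (h : ∀ k, coeff T k G' = ((freq T k : ℂ) * Complex.I) • coeff T k G) :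
    IsTimeDeriv T (fun t => ofFourier (G t)) (fun t => ofFourier (G' t)) := by
  intro φ
  have e : ∀ h : L2, ofFourier h φ = pairL ((𝓕⁻ φ).memLp 2) h := by
    intro h
    rw [(isFourierFun_ofFourier h).apply, pairL_apply]
  simp only [e]
  have h1 := (pairL ((𝓕⁻ φ).memLp 2)).comp_memLp' hG
  have h2 := (pairL ((𝓕⁻ φ).memLp 2)).comp_memLp' hG'
  refine ⟨h1.integrable one_le_two, h2.integrable one_le_two,
    isWeakDeriv_of_coeff hT h1 h2 fun k => ?_⟩
  have c1 := coeff_clm k (pairL ((𝓕⁻ φ).memLp 2)) (hG.integrable one_le_two)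
  have c2 := coeff_clm k (pairL ((𝓕⁻ φ).memLp 2)) (hG'.integrable one_le_two)
  refine c2.trans (Eq.trans ?_ (congrArg _ c1.symm))
  rw [ h, map_smul, smul_eq_mul]

/-! ### The symbols -/

lemma measurable_rieszSymbol (s : ℝ) : Measurable (rieszSymbol s) := by
  unfold rieszSymbol; fun_prop

lemma measurable_besselSymbol (s : ℝ) : Measurable (besselSymbol s) := by
  unfold besselSymbol; fun_prop

lemma ae_ne_zero : ∀ᵐ ξ : ℝ, ξ ≠ 0 := by
  simp [ae_iff]

lemma rieszSymbol_pos (s : ℝ) {ξ : ℝ} (hξ : ξ ≠ 0) : 0 < rieszSymbol s ξ := by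
  have := Real.pi_pos
  have := abs_pos.2 hξ
  unfold rieszSymbol; positivity

lemma rieszSymbol_zero (ξ : ℝ) : rieszSymbol 0 ξ = 1 := by
  simp [rieszSymbol]

lemma rieszSymbol_neg (s : ℝ) (ξ : ℝ) : rieszSymbol (-s) ξ = (rieszSymbol s ξ)⁻¹ := by
  have := Real.pi_pos
  unfold rieszSymbol
  exact Real.rpow_neg (by positivity) s

lemma rieszSymbol_half_sq (s : ℝ) (ξ : ℝ) :
    rieszSymbol (s / 2) ξ ^ 2 = rieszSymbol s ξ := by
  have := Real.pi_pos
  unfold rieszSymbol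
  rw [← Real.rpow_natCast, ← Real.rpow_mul (by positivity)]
  norm_num

lemma one_le_besselSymbol {s : ℝ} (hs : 0 ≤ s) (ξ : ℝ) : 1 ≤ besselSymbol s ξ := by
  unfold besselSymbol
  exact Real.one_le_rpow (by nlinarith [sq_nonneg (2 * Real.pi * |ξ|)]) (by positivity)

/-- Subadditivity of `x ↦ x ^ (s / 2)`, an exponent at most one. -/
lemma besselSymbol_sq_le {s : ℝ} (hs : 0 ≤ s) (hs' : s ≤ 2) (ξ : ℝ) :
    besselSymbol (s / 2) ξ ^ 2 ≤ 1 + rieszSymbol s ξ := by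
  have := Real.pi_pos
  have e1 : besselSymbol (s / 2) ξ ^ 2 = (1 + (2 * Real.pi * |ξ|) ^ 2) ^ (s / 2) := by
    unfold besselSymbol
    rw [← Real.rpow_natCast, ← Real.rpow_mul (by positivity)]
    norm_num
  have e2 : rieszSymbol s ξ = ((2 * Real.pi * |ξ|) ^ 2) ^ (s / 2) := by
    unfold rieszSymbol
    rw [← Real.rpow_natCast, ← Real.rpow_mul (by positivity)]
    congr 1
    push_cast; ring
  rw [e1, e2]
  refine (Real.rpow_add_le_add_rpow zero_le_one (by positivity) (by positivity)
    (by linarith)).trans (le_of_eq ?_)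
  rw [Real.one_rpow]

lemma invLinearGrowth_one : InvLinearGrowth fun _ => 1 :=
  ⟨measurable_const, by simp, 1, zero_le_one, fun ξ => by simp⟩

lemma invLinearGrowth_besselSymbol {s : ℝ} (hs : 0 ≤ s) : InvLinearGrowth (besselSymbol s) := by
  refine ⟨measurable_besselSymbol s, ae_of_all _ fun ξ => ?_, 1, zero_le_one, fun ξ => ?_⟩
  · linarith [one_le_besselSymbol hs ξ]
  · have h := one_le_besselSymbol hs ξ
    rw [abs_of_pos (by linarith), one_mul]
    exact (inv_le_one_of_one_le₀ h).trans (by linarith [abs_nonneg ξ])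

/-- For such `s`, `(2π|ξ|) ^ s ≤ 1 + 2π|ξ| ≤ (1 + 2π)(1 + |ξ|)`. -/
lemma invLinearGrowth_rieszSymbol_neg {s : ℝ} (hs : 0 ≤ s) (hs' : s ≤ 1) :
    InvLinearGrowth (rieszSymbol (-s)) := by
  have hpi := Real.pi_pos
  refine ⟨measurable_rieszSymbol _, ae_ne_zero.mono fun ξ hξ => (rieszSymbol_pos _ hξ).ne',
    1 + 2 * Real.pi, by positivity, fun ξ => ?_⟩
  rw [rieszSymbol_neg, abs_inv, inv_inv]
  have hp : (0 : ℝ) ≤ 2 * Real.pi * |ξ| := by positivity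
  have h1 : |rieszSymbol s ξ| ≤ 1 + 2 * Real.pi * |ξ| := by
    unfold rieszSymbol
    rw [abs_of_nonneg (by positivity)]
    calc (2 * Real.pi * |ξ|) ^ s ≤ (1 + 2 * Real.pi * |ξ|) ^ s := by gcongr; linarith
      _ ≤ (1 + 2 * Real.pi * |ξ|) ^ (1 : ℝ) :=
        Real.rpow_le_rpow_of_exponent_le (by linarith) hs'
      _ = _ := Real.rpow_one _
  nlinarith [abs_nonneg ξ]

/-- The symbol of the inverse of `∂ₜ + κ Λ ^ α` at the time frequency `τ`. -/
def resolventSymbol (κ α τ ξ : ℝ) : ℂ :=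
  ((τ : ℂ) * Complex.I + ((κ * rieszSymbol α ξ : ℝ) : ℂ))⁻¹

lemma measurable_resolventSymbol (κ α τ : ℝ) : Measurable (resolventSymbol κ α τ) := by
  have := measurable_rieszSymbol α
  unfold resolventSymbol
  fun_prop

/-- The real part `κ r` is positive, whatever the time frequency, zero included. -/
lemma resolvent_denom_ne_zero {κ : ℝ} (hκ : 0 < κ) (α τ : ℝ) {ξ : ℝ} (hξ : ξ ≠ 0) :
    (τ : ℂ) * Complex.I + ((κ * rieszSymbol α ξ : ℝ) : ℂ) ≠ 0 := by
  have hp := mul_pos hκ (rieszSymbol_pos α hξ)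
  intro h
  have := congrArg Complex.re h
  simp only [Complex.add_re, Complex.mul_re, Complex.ofReal_re, Complex.I_re, Complex.ofReal_im,
    Complex.I_im, Complex.zero_re] at this
  linarith

lemma norm_resolventSymbol_sq (κ α τ ξ : ℝ) :
    ‖resolventSymbol κ α τ ξ‖ ^ 2 = (τ ^ 2 + (κ * rieszSymbol α ξ) ^ 2)⁻¹ := by
  rw [resolventSymbol, norm_inv, inv_pow, Complex.sq_norm, Complex.normSq_apply]
  congr 1
  simp
  ring

lemma norm_riesz_resolvent_sq_le {κ : ℝ} (hκ : 0 < κ) (α τ : ℝ) {ξ : ℝ} (hξ : ξ ≠ 0) :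
    ‖(rieszSymbol α ξ : ℂ) * resolventSymbol κ α τ ξ‖ ^ 2 ≤ (κ⁻¹) ^ 2 := by
  have hp := rieszSymbol_pos α hξ
  rw [norm_mul, mul_pow, norm_resolventSymbol_sq, Complex.norm_real, Real.norm_eq_abs, sq_abs,
    ← div_eq_mul_inv, div_le_iff₀ (by positivity), mul_pow]
  have : κ⁻¹ ^ 2 * (τ ^ 2 + κ ^ 2 * rieszSymbol α ξ ^ 2)
      = κ⁻¹ ^ 2 * τ ^ 2 + rieszSymbol α ξ ^ 2 := by field_simp
  rw [this]
  linarith [(by positivity : 0 ≤ κ⁻¹ ^ 2 * τ ^ 2)]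

lemma norm_freq_resolvent_sq_le (κ α τ ξ : ℝ) :
    ‖((τ : ℂ) * Complex.I) * resolventSymbol κ α τ ξ‖ ^ 2 ≤ 1 := by
  rw [norm_mul, mul_pow, norm_resolventSymbol_sq, norm_mul, Complex.norm_I, mul_one,
    Complex.norm_real, Real.norm_eq_abs, sq_abs, ← div_eq_mul_inv]
  exact div_le_one_of_le₀ (by linarith [sq_nonneg (κ * rieszSymbol α ξ)]) (by positivity)

/-- Write `1 + r = (r⁻² + r⁻¹) r²` and spend `r²` on `r |q| ≤ 1/κ`; the remaining weights are those
of `Ḣ^(-α)` and `Ḣ^(-α/2)`. -/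
lemma norm_bessel_resolvent_sq_le {κ α : ℝ} (hκ : 0 < κ) (h0 : 0 ≤ α) (h2 : α ≤ 2) (τ : ℝ) {ξ : ℝ}
    (hξ : ξ ≠ 0) :
    ‖(besselSymbol (α / 2) ξ : ℂ) * resolventSymbol κ α τ ξ‖ ^ 2 ≤
      (κ⁻¹) ^ 2 * (rieszSymbol (-α) ξ ^ 2 + rieszSymbol (-(α / 2)) ξ ^ 2) := by
  have hp := rieszSymbol_pos α hξ
  have hr := norm_riesz_resolvent_sq_le hκ α τ hξ
  rw [norm_mul, mul_pow, Complex.norm_real, Real.norm_eq_abs, sq_abs] at hr ⊢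
  rw [rieszSymbol_neg, rieszSymbol_neg, inv_pow (rieszSymbol (α / 2) ξ), rieszSymbol_half_sq]
  calc besselSymbol (α / 2) ξ ^ 2 * ‖resolventSymbol κ α τ ξ‖ ^ 2
      ≤ (1 + rieszSymbol α ξ) * ‖resolventSymbol κ α τ ξ‖ ^ 2 := by
        gcongr; exact besselSymbol_sq_le h0 h2 ξ
    _ = ((rieszSymbol α ξ)⁻¹ ^ 2 + (rieszSymbol α ξ)⁻¹) *
          (rieszSymbol α ξ ^ 2 * ‖resolventSymbol κ α τ ξ‖ ^ 2) := by field_simp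
    _ ≤ ((rieszSymbol α ξ)⁻¹ ^ 2 + (rieszSymbol α ξ)⁻¹) * (κ⁻¹) ^ 2 := by gcongr
    _ = _ := by ring

/-- In `τ² (1 + r) |q|²` the term `1` is controlled by `|τ| |q| ≤ 1`, and the term `r = r⁻¹ r²` by
`r |q| ≤ 1/κ`. -/
lemma norm_freq_bessel_resolvent_sq_le {κ α : ℝ} (hκ : 0 < κ) (h0 : 0 ≤ α) (h2 : α ≤ 2) (τ : ℝ)
    {ξ : ℝ} (hξ : ξ ≠ 0) :
    ‖((τ : ℂ) * Complex.I) * ((besselSymbol (α / 2) ξ : ℂ) * resolventSymbol κ α τ ξ)‖ ^ 2 ≤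
      1 + (κ⁻¹) ^ 2 * (τ * rieszSymbol (-(α / 2)) ξ) ^ 2 := by
  have hp := rieszSymbol_pos α hξ
  have hr := norm_riesz_resolvent_sq_le hκ α τ hξ
  have hq := norm_freq_resolvent_sq_le κ α τ ξ
  rw [norm_mul, norm_mul, Complex.norm_I, mul_one, mul_pow, Complex.norm_real,
    Real.norm_eq_abs, sq_abs] at hq
  rw [norm_mul, norm_mul, norm_mul, Complex.norm_I, mul_one, mul_pow, mul_pow, Complex.norm_real,
    Complex.norm_real, Real.norm_eq_abs, Real.norm_eq_abs, sq_abs, sq_abs]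
  rw [norm_mul, mul_pow, Complex.norm_real, Real.norm_eq_abs, sq_abs] at hr
  rw [rieszSymbol_neg, mul_pow τ, inv_pow (rieszSymbol (α / 2) ξ), rieszSymbol_half_sq]
  calc τ ^ 2 * (besselSymbol (α / 2) ξ ^ 2 * ‖resolventSymbol κ α τ ξ‖ ^ 2)
      ≤ τ ^ 2 * ((1 + rieszSymbol α ξ) * ‖resolventSymbol κ α τ ξ‖ ^ 2) := by
        gcongr; exact besselSymbol_sq_le h0 h2 ξ
    _ = τ ^ 2 * ‖resolventSymbol κ α τ ξ‖ ^ 2 + (τ ^ 2 * (rieszSymbol α ξ)⁻¹) *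
          (rieszSymbol α ξ ^ 2 * ‖resolventSymbol κ α τ ξ‖ ^ 2) := by field_simp
    _ ≤ 1 + (τ ^ 2 * (rieszSymbol α ξ)⁻¹) * (κ⁻¹) ^ 2 := by gcongr
    _ = _ := by ring

/-! ### Multipliers depending on the time frequency -/

lemma norm_sq_eq_integral (g : L2) : ‖g‖ ^ 2 = ∫ ξ, ‖g ξ‖ ^ 2 := by
  rw [← inner_self_eq_norm_sq (𝕜 := ℂ), L2.inner_def, ← integral_re]
  · refine integral_congr_ae (ae_of_all _ fun ξ => ?_)
    exact inner_self_eq_norm_sq (𝕜 := ℂ) (g ξ)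
  · exact L2.integrable_inner g g

lemma exists_mul_of_sq_le {m : ℝ → ℂ} (hm : Measurable m) {F X Y : L2} {s t : ℝ}
    (h : ∀ᵐ ξ, ‖m ξ * F ξ‖ ^ 2 ≤ s * ‖X ξ‖ ^ 2 + t * ‖Y ξ‖ ^ 2) :
    ∃ g : L2, (g =ᵐ[volume] fun ξ => m ξ * F ξ) ∧ ‖g‖ ^ 2 ≤ s * ‖X‖ ^ 2 + t * ‖Y‖ ^ 2 := by
  have hsq : ∀ G : L2, Integrable fun ξ => ‖G ξ‖ ^ 2 := fun G =>
    (memLp_two_iff_integrable_sq_norm (Lp.memLp G).1).1 (Lp.memLp G)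
  have hi : Integrable fun ξ => s * ‖X ξ‖ ^ 2 + t * ‖Y ξ‖ ^ 2 :=
    ((hsq X).const_mul s).add ((hsq Y).const_mul t)
  have hms : AEStronglyMeasurable (fun ξ => m ξ * F ξ) volume :=
    hm.aestronglyMeasurable.mul (Lp.memLp F).1
  have hmem : MemLp (fun ξ => m ξ * F ξ) 2 volume := by
    refine (memLp_two_iff_integrable_sq_norm hms).2 (hi.mono' (hms.norm.pow 2) ?_)
    filter_upwards [h] with ξ hξ
    rwa [Real.norm_eq_abs, abs_of_nonneg (by positivity)]
  refine ⟨hmem.toLp _, hmem.coeFn_toLp, ?_⟩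
  rw [norm_sq_eq_integral, norm_sq_eq_integral, norm_sq_eq_integral, ← integral_const_mul,
    ← integral_const_mul, ← integral_add ((hsq X).const_mul s) ((hsq Y).const_mul t)]
  refine integral_mono_ae (hsq _) hi ?_
  filter_upwards [h, hmem.coeFn_toLp] with ξ h1 h2
  rw [h2]
  exact h1

lemma secondCountable_L2 : SecondCountableTopology L2 := by
  have : Fact ((2 : ℝ≥0∞) ≠ ⊤) := ⟨by norm_num⟩
  infer_instance

/-- A map in `L²(0, T; L²)` whose Fourier coefficients are obtained by multipliers. -/
lemma exists_multiplier {T : ℝ} (hT : 0 < T) {m : ℤ → ℝ → ℂ} (hm : ∀ k, Measurable (m k))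
    {F X Y : Lp L2 2 (timeMeasure T)} {s t : ℝ}
    (h : ∀ k, ∀ᵐ ξ, ‖m k ξ * (coeff T k F : L2) ξ‖ ^ 2 ≤
      s * ‖(coeff T k X : L2) ξ‖ ^ 2 + t * ‖(coeff T k Y : L2) ξ‖ ^ 2) :
    ∃ U : Lp L2 2 (timeMeasure T),
      (∀ k, (coeff T k U : L2) =ᵐ[volume] fun ξ => m k ξ * (coeff T k F : L2) ξ) ∧
      ‖U‖ ^ 2 ≤ s * ‖X‖ ^ 2 + t * ‖Y‖ ^ 2 := by
  have := secondCountable_L2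
  choose c hc1 hc2 using fun k => exists_mul_of_sq_le (hm k) (h k)
  have hs := ((hasSum_norm_coeff_sq hT X).mul_left s).add ((hasSum_norm_coeff_sq hT Y).mul_left t)
  have hcs : Summable fun k => ‖c k‖ ^ 2 :=
    hs.summable.of_nonneg_of_le (fun k => by positivity) hc2
  obtain ⟨U, hU⟩ := exists_coeff_eq hT hcs
  refine ⟨U, fun k => by rw [hU]; exact hc1 k, ?_⟩
  have hUs := hasSum_norm_coeff_sq hT U
  simp only [hU] at hUs
  exact hasSum_le hc2 hUs hs

/-! ### Real distributions -/

/-- The map `h ↦ conj h(-·)`, which is complex conjugation on the frequency side. -/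
def reflConj : L2 →L[ℝ] L2 :=
  (Complex.conjCLE : ℂ →L[ℝ] ℂ).compLpL 2 volume ∘L
    (Lp.compMeasurePreservingₗᵢ ℝ (fun ξ : ℝ => -ξ)
      (Measure.measurePreserving_neg volume)).toContinuousLinearMap

lemma coeFn_reflConj (h : L2) : reflConj h =ᵐ[volume] fun ξ => starRingEnd ℂ (h (-ξ)) := by
  filter_upwards [(Complex.conjCLE : ℂ →L[ℝ] ℂ).coeFn_compLpL
      (Lp.compMeasurePreserving (fun ξ : ℝ => -ξ) (Measure.measurePreserving_neg volume) h),
    Lp.coeFn_compMeasurePreserving h (Measure.measurePreserving_neg volume)] with ξ e1 e2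
  refine e1.trans ?_
  rw [e2]
  rfl

lemma reflConj_smul (c : ℂ) (h : L2) : reflConj (c • h) = starRingEnd ℂ c • reflConj h := by
  refine Lp.ext ?_
  have hq := (Measure.measurePreserving_neg (volume : Measure ℝ)).quasiMeasurePreserving
  filter_upwards [coeFn_reflConj (c • h), hq.ae (Lp.coeFn_smul c h),
    Lp.coeFn_smul (starRingEnd ℂ c) (reflConj h), coeFn_reflConj h] with ξ e1 e2 e3 e4
  rw [e1, e2, e3, Pi.smul_apply, Pi.smul_apply, e4]
  simp

/-- `reflConj` is antilinear, so pulling it out of the integral conjugates the wave and reverses its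
frequency. -/
lemma coeff_reflConj {T : ℝ} {F : ℝ → L2} (hF : Integrable F (timeMeasure T)) (k : ℤ) :
    coeff T k (fun t => reflConj (F t)) = reflConj (coeff T (-k) F) := by
  simp only [coeff]
  refine Eq.trans ?_
    (ContinuousLinearMap.integral_comp_comm reflConj (integrable_conj_wave_smul (-k) hF))
  simp only [reflConj_smul, conj_wave, neg_neg]
  rfl

/-- The complex conjugate of a Schwartz function. -/
def conjSchwartz (φ : 𝓢(ℝ, ℂ)) : 𝓢(ℝ, ℂ) :=
  SchwartzMap.postcompCLM (𝕜 := ℝ) (Complex.conjCLE : ℂ →L[ℝ] ℂ) φ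

lemma conjSchwartz_apply (φ : 𝓢(ℝ, ℂ)) (x : ℝ) : conjSchwartz φ x = starRingEnd ℂ (φ x) := rfl

lemma fourierInv_conjSchwartz (φ : 𝓢(ℝ, ℂ)) (ξ : ℝ) :
    (𝓕⁻ (conjSchwartz φ)) ξ = starRingEnd ℂ ((𝓕⁻ φ) (-ξ)) := by
  rw [SchwartzMap.fourierInv_coe, SchwartzMap.fourierInv_coe, Real.fourierInv_eq',
    Real.fourierInv_eq', ← integral_conj]
  refine integral_congr_ae (ae_of_all _ fun x => ?_)
  simp only [conjSchwartz_apply, smul_eq_mul, map_mul, ← Complex.exp_conj, Complex.conj_ofReal,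
    Complex.conj_I]
  congr 2
  simp

/-- Split a test function as `a + i b`, where `a` and `b` are its real and imaginary parts. -/
lemma isRealDistribution_iff {v : 𝓢'(ℝ, ℂ)} :
    IsRealDistribution v ↔ ∀ φ, v φ = starRingEnd ℂ (v (conjSchwartz φ)) := by
  constructor
  · intro hv φ
    obtain ⟨a, ha⟩ : ∃ a : 𝓢(ℝ, ℂ), a = (2⁻¹ : ℂ) • (φ + conjSchwartz φ) := ⟨_, rfl⟩
    obtain ⟨b, hb⟩ : ∃ b : 𝓢(ℝ, ℂ), b = (-(2⁻¹ * Complex.I) : ℂ) • (φ - conjSchwartz φ) :=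
      ⟨_, rfl⟩
    have ha' : (v a).im = 0 := hv a fun x => by
      simp [ha, conjSchwartz_apply]
    have hb' : (v b).im = 0 := hv b fun x => by
      simp [hb, conjSchwartz_apply]
    have e1 : φ = a + Complex.I • b := by
      ext x
      simp only [ha, hb, add_apply, smul_apply, sub_apply,
        smul_eq_mul]
      linear_combination ((φ x - conjSchwartz φ x) / 2) * Complex.I_mul_I
    have e2 : conjSchwartz φ = a - Complex.I • b := by
      ext x
      simp only [ha, hb, add_apply, smul_apply, sub_apply,
        smul_eq_mul]
      linear_combination (-(φ x - conjSchwartz φ x) / 2) * Complex.I_mul_I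
    rw [e2]
    conv_lhs => rw [e1]
    rw [map_add, map_sub (v : 𝓢(ℝ, ℂ) →L[ℂ] ℂ), map_smul, map_sub, smul_eq_mul, map_mul,
      Complex.conj_I,
      Complex.conj_eq_iff_im.2 ha', Complex.conj_eq_iff_im.2 hb']
    ring
  · intro hv φ hφ
    have : conjSchwartz φ = φ := by
      ext x
      rw [conjSchwartz_apply, Complex.conj_eq_iff_im.2 (hφ x)]
    have h := hv φ
    rw [this] at h
    exact Complex.conj_eq_iff_im.1 h.symm

/-- The substitution `ξ ↦ -ξ` moves the conjugation from the test function to the Fourier transform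
of `v`. -/
lemma isRealDistribution_iff_reflConj {v : 𝓢'(ℝ, ℂ)} {h : L2} (hv : IsFourierFun v h) :
    IsRealDistribution v ↔ reflConj h = h := by
  have key : ∀ φ : 𝓢(ℝ, ℂ), starRingEnd ℂ (v (conjSchwartz φ)) = ∫ ξ, (𝓕⁻ φ) ξ * reflConj h ξ := by
    intro φ
    rw [hv.apply, ← integral_conj]
    refine (integral_neg_eq_self
      (fun ξ => starRingEnd ℂ ((𝓕⁻ (conjSchwartz φ)) ξ * h ξ)) volume).symm.trans ?_
    refine integral_congr_ae ?_
    filter_upwards [coeFn_reflConj h] with ξ e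
    rw [e, map_mul, fourierInv_conjSchwartz]
    simp
  rw [isRealDistribution_iff]
  constructor
  · intro H
    refine Lp.ext (ae_eq_of_forall_schwartz (fun φ => integrable_schwartz_mul φ _)
      (fun φ => integrable_schwartz_mul φ _) fun φ => ?_)
    have := H (𝓕 φ)
    rw [key, hv.apply_fourier, FourierTransform.fourierInv_fourier_eq] at this
    exact this.symm
  · intro H φ
    rw [key, H, hv.apply]

/-! ### The periodic problem on the frequency side -/

lemma exists_lp_lift {T : ℝ} {m : ℝ → ℝ} {u : ℝ → 𝓢'(ℝ, ℂ)} (h : normL2 T m u < ⊤) :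
    ∃ G : Lp L2 2 (timeMeasure T), ∀ᵐ t ∂(timeMeasure T), IsFourierLift m (u t) (G t) := by
  obtain ⟨G, h1, h2⟩ := exists_lift_of_normL2_lt_top h
  refine ⟨h1.toLp G, ?_⟩
  filter_upwards [h2, h1.coeFn_toLp] with t e1 e2
  rwa [e2]

lemma normL2_eq_ofReal {T : ℝ} {m : ℝ → ℝ} {u : ℝ → 𝓢'(ℝ, ℂ)} {G : Lp L2 2 (timeMeasure T)}
    (h : ∀ᵐ t ∂(timeMeasure T), IsFourierLift m (u t) (G t)) :
    normL2 T m u = ENNReal.ofReal ‖G‖ := by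
  rw [normL2_eq (Lp.memLp G).1 h, Lp.norm_def, ENNReal.ofReal_toReal (Lp.eLpNorm_ne_top G)]

lemma exists_timeDeriv_of_normH1_lt_top {T : ℝ} {m : ℝ → ℝ} {u : ℝ → 𝓢'(ℝ, ℂ)}
    (h : normH1 T m u < ⊤) :
    normL2 T m u < ⊤ ∧ ∃ u' : ℝ → 𝓢'(ℝ, ℂ), IsTimeDeriv T u u' ∧ normL2 T m u' < ⊤ := by
  simp only [normH1, iInf_lt_iff] at h
  obtain ⟨u', h1, h2⟩ := h
  rw [ENNReal.rpow_lt_top_iff_of_pos (by norm_num), ENNReal.add_lt_top] at h2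
  have h3 : ∀ x : ℝ≥0∞, x ^ 2 < ⊤ → x < ⊤ := fun x hx => by
    rw [lt_top_iff_ne_top] at hx ⊢
    exact fun h => hx (by simp [h])
  exact ⟨h3 _ h2.1, u', h1, h3 _ h2.2⟩

lemma rpow_half_ofReal {a b : ℝ} (ha : 0 ≤ a) (hb : 0 ≤ b) :
    (ENNReal.ofReal a ^ 2 + ENNReal.ofReal b ^ 2) ^ (1 / 2 : ℝ) =
      ENNReal.ofReal √(a ^ 2 + b ^ 2) := by
  rw [← ENNReal.ofReal_pow ha, ← ENNReal.ofReal_pow hb, ← ENNReal.ofReal_add (by positivity)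
    (by positivity), ENNReal.ofReal_rpow_of_nonneg (by positivity) (by norm_num),
    Real.sqrt_eq_rpow]

lemma coeff_timeDeriv_same {T : ℝ} (hT : 0 < T) {f f' : ℝ → 𝓢'(ℝ, ℂ)} {m : ℝ → ℝ}
    (hm : InvLinearGrowth m) {G G' : Lp L2 2 (timeMeasure T)} (hf : IsTimeDeriv T f f')
    (hG : ∀ᵐ t ∂(timeMeasure T), IsFourierLift m (f t) (G t))
    (hG' : ∀ᵐ t ∂(timeMeasure T), IsFourierLift m (f' t) (G' t)) (hper : EqAtEndpoints T m f)
    (k : ℤ) : coeff T k G' = ((freq T k : ℂ) * Complex.I) • coeff T k G := by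
  refine Lp.ext ?_
  filter_upwards [coeff_timeDeriv hT hm hm hf (Lp.memLp G) (Lp.memLp G') hG hG' hper k, hm.2.1,
    Lp.coeFn_smul ((freq T k : ℂ) * Complex.I) (coeff T k G)] with ξ e1 e2 e3
  have e2' : (m ξ : ℂ) ≠ 0 := by exact_mod_cast e2
  rw [e3, Pi.smul_apply, smul_eq_mul]
  field_simp at e1
  exact e1

/-- The end condition forces the coefficients of every weak derivative with finite norm, so all of
these have the lift `G'`; the other competitors contribute `∞`. -/
lemma le_normH1 {T : ℝ} (hT : 0 < T) {f : ℝ → 𝓢'(ℝ, ℂ)} {m : ℝ → ℝ}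
    (hm : InvLinearGrowth m) {G G' : Lp L2 2 (timeMeasure T)}
    (hG : ∀ᵐ t ∂(timeMeasure T), IsFourierLift m (f t) (G t)) (hper : EqAtEndpoints T m f)
    (hG' : ∀ k, coeff T k G' = ((freq T k : ℂ) * Complex.I) • coeff T k G) :
    ENNReal.ofReal √(‖G‖ ^ 2 + ‖G'‖ ^ 2) ≤ normH1 T m f := by
  have := secondCountable_L2
  refine le_iInf₂ fun f' hf' => ?_
  by_cases htop : normL2 T m f' < ⊤
  · obtain ⟨G'', h2⟩ := exists_lp_lift htop
    have : G'' = G' := by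
      refine Lp.ext (ae_eq_of_coeff_eq hT (Lp.memLp _) (Lp.memLp _) fun k => ?_)
      rw [hG' k, coeff_timeDeriv_same hT hm hf' hG h2 hper]
    rw [normL2_eq_ofReal hG, normL2_eq_ofReal h2, this,
      rpow_half_ofReal (norm_nonneg _) (norm_nonneg _)]
  · rw [not_lt_top_iff] at htop
    rw [htop]
    simp

lemma besselSymbol_ne_zero {s : ℝ} (hs : 0 ≤ s) (ξ : ℝ) : (besselSymbol s ξ : ℂ) ≠ 0 := by
  have := one_le_besselSymbol hs ξ
  exact_mod_cast (by linarith : besselSymbol s ξ ≠ 0)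

lemma memLp_top_inv_besselSymbol {s : ℝ} (hs : 0 ≤ s) :
    MemLp (fun ξ => (besselSymbol s ξ : ℂ)⁻¹) ⊤ volume := by
  refine memLp_top_of_bound (C := 1) ?_ (ae_of_all _ fun ξ => ?_)
  · exact (Complex.measurable_ofReal.comp (measurable_besselSymbol s)).inv.aestronglyMeasurable
  · have := one_le_besselSymbol hs ξ
    rw [norm_inv, Complex.norm_real, Real.norm_eq_abs, abs_of_pos (by linarith)]
    exact inv_le_one_of_one_le₀ this

/-- The Fourier coefficients of a periodic strong solution. -/
lemma ae_eq_of_isPeriodicStrongSolution {κ α T : ℝ} (hκ : 0 < κ) (h0 : 0 ≤ α) (hT : 0 < T)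
    {f v : ℝ → 𝓢'(ℝ, ℂ)} {F U : Lp L2 2 (timeMeasure T)}
    (hF : ∀ᵐ t ∂(timeMeasure T), IsFourierFun (f t) (F t))
    (hU : ∀ k, (coeff T k U : L2) =ᵐ[volume]
      fun ξ => resolventSymbol κ α (freq T k) ξ * (coeff T k F : L2) ξ)
    (hv : IsPeriodicStrongSolution κ α T f v) :
    ∀ᵐ t ∂(timeMeasure T), v t = ofFourier (U t) := by
  have := secondCountable_L2
  obtain ⟨hY, ⟨v', hv', heq⟩, hper⟩ := hv
  have hs : 0 ≤ α / 2 := by linarith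
  have hb := invLinearGrowth_besselSymbol hs
  rw [normY, ENNReal.add_lt_top] at hY
  obtain ⟨B, hB⟩ := exists_lp_lift (exists_timeDeriv_of_normH1_lt_top hY.1).1
  obtain ⟨A, hA⟩ := exists_lp_lift hY.2
  have hV : MemLp (fun t => mulOp _ (memLp_top_inv_besselSymbol hs) (B t)) 2 (timeMeasure T) :=
    memLp_clm_comp _ (Lp.memLp B)
  have hBV : ∀ t, (mulOp _ (memLp_top_inv_besselSymbol hs) (B t) : L2) =ᵐ[volume]
      fun ξ => (besselSymbol (α / 2) ξ : ℂ)⁻¹ * B t ξ := fun t => coeFn_mulOp _ _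
  have hvV : ∀ᵐ t ∂(timeMeasure T),
      IsFourierFun (v t) (mulOp _ (memLp_top_inv_besselSymbol hs) (B t)) := by
    filter_upwards [hB] with t ht
    obtain ⟨h, h1, h2⟩ := ht
    refine h1.congr ?_
    filter_upwards [h2, hBV t] with ξ e1 e2
    rw [e2, e1, inv_mul_cancel_left₀ (besselSymbol_ne_zero hs ξ)]
  have hQ : MemLp (fun t => F t + (-(κ : ℂ)) • A t) 2 (timeMeasure T) :=
    (Lp.memLp F).add ((Lp.memLp A).const_smul (-(κ : ℂ)))
  -- The derivative in the equation need not be one that nearly attains `normH1`. The equation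
  -- itself puts it in `L²`, hence the symbol `1`.
  have hvQ : ∀ᵐ t ∂(timeMeasure T),
      IsFourierLift (fun _ => 1) (v' t) (F t + (-(κ : ℂ)) • A t) := by
    filter_upwards [heq, hA, hF] with t e1 e2 e3
    obtain ⟨w, h1, h2⟩ := e1
    have h3 : 𝓕 w = A t := (sobolevLift_iff.1 h1).unique e2
    have h4 : v' t = f t + (-(κ : ℂ)) • (w : 𝓢'(ℝ, ℂ)) := by rw [← h2, neg_smul]; abel
    have h5 := isFourierFun_coe w
    rw [h3] at h5
    refine ⟨fun ξ => F t ξ + -(κ : ℂ) * A t ξ, ?_, ?_⟩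
    · rw [h4]
      exact e3.add (h5.smul _)
    · filter_upwards [Lp.coeFn_add (F t) ((-(κ : ℂ)) • A t), Lp.coeFn_smul (-(κ : ℂ)) (A t)]
        with ξ g1 g2
      rw [g1, Pi.add_apply, g2]
      simp
  have hcoV := coeff_mul (T := T) (m := fun ξ => (besselSymbol (α / 2) ξ : ℂ)⁻¹)
    (Complex.measurable_ofReal.comp hb.1).inv ((Lp.memLp B).integrable one_le_two)
    (hV.integrable one_le_two) (ae_of_all _ hBV)
  have hcoA := coeff_mul (T := T) (m := fun ξ => (rieszSymbol α ξ : ℂ))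
    (Complex.measurable_ofReal.comp (measurable_rieszSymbol α)) (hV.integrable one_le_two)
    ((Lp.memLp A).integrable one_le_two) (by
      filter_upwards [hA, hvV] with t e1 e2
      exact e1.ae_eq e2)
  have hcoQ := coeff_timeDeriv hT hb invLinearGrowth_one hv' (Lp.memLp B) hQ hB hvQ hper
  -- The coefficients satisfy `(iτ + κ r) V_k = F_k`, which determines them off `ξ = 0`.
  have hVU : ∀ᵐ t ∂(timeMeasure T), mulOp _ (memLp_top_inv_besselSymbol hs) (B t) = U t := by
    refine ae_eq_of_coeff_eq hT hV (Lp.memLp U) fun k => Lp.ext ?_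
    have hsplit : coeff T k (fun t => F t + (-(κ : ℂ)) • A t) =
        coeff T k F + (-(κ : ℂ)) • coeff T k A :=
      coeff_add_smul k _ ((Lp.memLp F).integrable one_le_two) ((Lp.memLp A).integrable one_le_two)
    have hq := hcoQ k
    rw [hsplit] at hq
    filter_upwards [hq, hcoV k, hcoA k, hU k, ae_ne_zero,
      Lp.coeFn_add (coeff T k F) ((-(κ : ℂ)) • coeff T k A),
      Lp.coeFn_smul (-(κ : ℂ)) (coeff T k A)] with ξ e1 e2 e3 e4 e5 e6 e7
    rw [← e2, e6, Pi.add_apply, e7, Pi.smul_apply, e3] at e1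
    have hne := resolvent_denom_ne_zero hκ α (freq T k) e5
    rw [e4, resolventSymbol, eq_inv_mul_iff_mul_eq₀ hne]
    push_cast at e1 ⊢
    rw [inv_one, one_mul, smul_eq_mul] at e1
    linear_combination -e1
  filter_upwards [hvV, hVU] with t e1 e2
  rw [e2] at e1
  exact e1.eq (isFourierFun_ofFourier _)

/-- Reality is inherited by the solution. -/
lemma isRealDistribution_ofFourier {κ α T : ℝ} (hT : 0 < T)
    {f : ℝ → 𝓢'(ℝ, ℂ)} {F U : Lp L2 2 (timeMeasure T)}
    (hF : ∀ᵐ t ∂(timeMeasure T), IsFourierFun (f t) (F t))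
    (hU : ∀ k, (coeff T k U : L2) =ᵐ[volume]
      fun ξ => resolventSymbol κ α (freq T k) ξ * (coeff T k F : L2) ξ)
    (hf : ∀ᵐ t ∂(timeMeasure T), IsRealDistribution (f t)) :
    ∀ᵐ t ∂(timeMeasure T), IsRealDistribution (ofFourier (U t)) := by
  have := secondCountable_L2
  have hFr : ∀ᵐ t ∂(timeMeasure T), reflConj (F t) = F t := by
    filter_upwards [hF, hf] with t e1 e2
    exact (isRealDistribution_iff_reflConj e1).1 e2
  have hFk : ∀ k, reflConj (coeff T (-k) F) = coeff T k F := fun k => by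
    rw [← coeff_reflConj ((Lp.memLp F).integrable one_le_two)]
    exact coeff_congr k hFr
  have hUr : ∀ᵐ t ∂(timeMeasure T), reflConj (U t) = U t := by
    refine ae_eq_of_coeff_eq hT (reflConj.comp_memLp' (Lp.memLp U)) (Lp.memLp U) fun k => ?_
    refine (coeff_reflConj ((Lp.memLp U).integrable one_le_two) k).trans (Lp.ext ?_)
    have hq := (Measure.measurePreserving_neg (volume : Measure ℝ)).quasiMeasurePreserving
    have e5 := coeFn_reflConj (coeff T (-k) F)
    rw [hFk] at e5
    filter_upwards [coeFn_reflConj (coeff T (-k) U), hq.ae (hU (-k)), hU k, e5]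
      with ξ e1 e2 e3 e4
    rw [e1, e2, e3, e4, map_mul]
    congr 1
    -- Conjugation and `k ↦ -k` both change the sign of `iτ`, while `rieszSymbol` is real and even.
    simp only [resolventSymbol, map_inv₀, map_add, map_mul, Complex.conj_ofReal, Complex.conj_I,
      freq_neg, rieszSymbol, abs_neg]
    congr 2
    push_cast
    ring
  filter_upwards [hUr] with t ht
  exact (isRealDistribution_iff_reflConj (isFourierFun_ofFourier (U t))).2 ht

/-- Multiplier relations between coefficients give lifts. -/
lemma isFourierLift_ofFourier {T : ℝ} (hT : 0 < T) {m : ℝ → ℝ} (hm : Measurable m)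
    {U V : Lp L2 2 (timeMeasure T)}
    (h : ∀ k, (coeff T k V : L2) =ᵐ[volume] fun ξ => (m ξ : ℂ) * (coeff T k U : L2) ξ) :
    ∀ᵐ t ∂(timeMeasure T), IsFourierLift m (ofFourier (U t)) (V t) := by
  filter_upwards [ae_eq_mul_of_coeff hT (Complex.measurable_ofReal.comp hm) (Lp.memLp U)
    (Lp.memLp V) h] with t ht
  exact ⟨_, isFourierFun_ofFourier _, ht⟩

/-- Square summability of `τ ‖B_k‖` gives `B` a continuous periodic representative; dividing it by
the Bessel symbol gives that of `U`. -/
lemma eqAtEndpoints_ofFourier {s T : ℝ} (hs : 0 ≤ s) (hT : 0 < T)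
    {U B B' : Lp L2 2 (timeMeasure T)}
    (hB : ∀ᵐ t ∂(timeMeasure T), IsFourierLift (besselSymbol s) (ofFourier (U t)) (B t))
    (hB' : ∀ k, coeff T k B' = ((freq T k : ℂ) * Complex.I) • coeff T k B) :
    EqAtEndpoints T (besselSymbol s) fun t => ofFourier (U t) := by
  have := secondCountable_L2
  obtain ⟨g, hg1, hg2, hg3⟩ := exists_continuous_periodic hT (Lp.memLp B) (by
    refine (hasSum_norm_coeff_sq hT B').summable.congr fun k => ?_
    rw [hB' k, norm_smul, norm_mul, Complex.norm_I, mul_one, Complex.norm_real, mul_pow, mul_pow,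
      Real.norm_eq_abs, sq_abs])
  have hlift : ∀ h : L2, IsFourierLift (besselSymbol s)
      (ofFourier (mulOp _ (memLp_top_inv_besselSymbol hs) h)) h := fun h => by
    refine ⟨_, isFourierFun_ofFourier _, ?_⟩
    filter_upwards [coeFn_mulOp (memLp_top_inv_besselSymbol hs) h] with ξ e
    rw [e, mul_inv_cancel_left₀ (besselSymbol_ne_zero hs ξ)]
  refine ⟨fun t => ofFourier (mulOp _ (memLp_top_inv_besselSymbol hs) (g t)), ?_,
    ⟨fun t => 𝓕⁻ (g t), ?_, fun t _ => sobolevLift_fourierInv (hlift _)⟩, by simp only [hg2]⟩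
  · filter_upwards [hB, hg3] with t e1 e2
    rw [e2] at e1
    congr 1
    refine Lp.ext ?_
    filter_upwards [e1.ae_eq (isFourierFun_ofFourier _),
      coeFn_mulOp (memLp_top_inv_besselSymbol hs) (g t)] with ξ h1 h2
    rw [h2, h1, inv_mul_cancel_left₀ (besselSymbol_ne_zero hs ξ)]
  · exact ((ContinuousFourierInv.continuous_fourierInv (E := L2)).comp hg1).continuousOn

/-- The squared root is at most `κ⁻² A² + κ⁻² S² + D² ≤ (κ⁻¹ A + κ⁻¹ S + D)²`. Adding `M ≤ κ⁻¹ D`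
gives total weight `1 + κ⁻¹` to `D` and only `κ⁻¹` to `A` and `S`. -/
lemma sum_norms_le {κ A B C D N N' M : ℝ} (hκ : 0 < κ) (hA : 0 ≤ A) (hD : 0 ≤ D)
    (hN : N ^ 2 ≤ κ⁻¹ ^ 2 * A ^ 2 + κ⁻¹ ^ 2 * B ^ 2)
    (hN' : N' ^ 2 ≤ D ^ 2 + κ⁻¹ ^ 2 * C ^ 2) (hM : M ^ 2 ≤ κ⁻¹ ^ 2 * D ^ 2) :
    √(N ^ 2 + N' ^ 2) + M ≤ (1 + 1 / κ) * (√(B ^ 2 + C ^ 2) + D + A) := by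
  have hκ' : 0 < κ⁻¹ := inv_pos.2 hκ
  set S := √(B ^ 2 + C ^ 2) with hS
  have hS0 : 0 ≤ S := Real.sqrt_nonneg _
  have hS2 : S ^ 2 = B ^ 2 + C ^ 2 := Real.sq_sqrt (by positivity)
  have h1 : √(N ^ 2 + N' ^ 2) ≤ κ⁻¹ * A + κ⁻¹ * S + D := by
    apply Real.sqrt_le_iff.2 ⟨by positivity, ?_⟩
    have : 0 ≤ (κ⁻¹ * A) * (κ⁻¹ * S) + (κ⁻¹ * A) * D + (κ⁻¹ * S) * D := by positivity
    calc N ^ 2 + N' ^ 2 ≤ κ⁻¹ ^ 2 * A ^ 2 + κ⁻¹ ^ 2 * S ^ 2 + D ^ 2 := by rw [hS2]; linarith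
      _ ≤ _ := by linarith
  have h2 : M ≤ κ⁻¹ * D := by
    rw [← mul_pow] at hM
    exact le_of_sq_le_sq hM (by positivity)
  rw [one_div]
  linarith

end FracHeat

end

/-! ### Existence, estimate, uniqueness and reality. -/

theorem theorem2p1 (κ α T : ℝ) (hκ : 0 < κ) (hα₁ : 1 < α) (hα₂ : α < 3 / 2) (hT : 0 < T)
    (f : ℝ → 𝓢'(ℝ, ℂ)) (hf : FracHeat.normX α T f < ⊤)
    (hper : FracHeat.EqAtEndpoints T (FracHeat.rieszSymbol (-(α / 2))) f) :
    ∃ u : ℝ → 𝓢'(ℝ, ℂ),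
      FracHeat.IsPeriodicStrongSolution κ α T f u ∧
      FracHeat.normY α T u ≤ ENNReal.ofReal (1 + 1 / κ) * FracHeat.normX α T f ∧
      (∀ v : ℝ → 𝓢'(ℝ, ℂ), FracHeat.IsPeriodicStrongSolution κ α T f v →
        ∀ᵐ t ∂(FracHeat.timeMeasure T), v t = u t) ∧
      ((∀ᵐ t ∂(FracHeat.timeMeasure T), FracHeat.IsRealDistribution (f t)) →
        ∀ᵐ t ∂(FracHeat.timeMeasure T), FracHeat.IsRealDistribution (u t)) := by
  open FracHeat in
  have := secondCountable_L2
  have h0 : 0 ≤ α := by linarith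
  have h2 : α ≤ 2 := by linarith
  have hs : 0 ≤ α / 2 := by linarith
  have hr1 := invLinearGrowth_rieszSymbol_neg hs (by linarith)
  have hX := hf
  rw [normX, ENNReal.add_lt_top, ENNReal.add_lt_top] at hX
  obtain ⟨⟨hX1, hX2⟩, hX3⟩ := hX
  obtain ⟨hX1a, f', hf', hX1b⟩ := exists_timeDeriv_of_normH1_lt_top hX1
  obtain ⟨F, hFl⟩ := exists_lp_lift hX2
  obtain ⟨F₂, hF₂⟩ := exists_lp_lift hX3
  obtain ⟨F₁, hF₁⟩ := exists_lp_lift hX1a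
  obtain ⟨F₁', hF₁'⟩ := exists_lp_lift hX1b
  have hF : ∀ᵐ t ∂(timeMeasure T), IsFourierFun (f t) (F t) := by
    filter_upwards [hFl] with t ht
    obtain ⟨h, e1, e2⟩ := ht
    refine e1.congr ?_
    filter_upwards [e2] with ξ e
    rw [e, rieszSymbol_zero, Complex.ofReal_one, one_mul]
  have hint : ∀ G : Lp L2 2 (timeMeasure T), Integrable G (timeMeasure T) :=
    fun G => (Lp.memLp G).integrable one_le_two
  have hc1 := coeff_mul (T := T) (m := fun ξ => (rieszSymbol (-(α / 2)) ξ : ℂ))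
    (Complex.measurable_ofReal.comp (measurable_rieszSymbol _)) (hint F) (hint F₁) (by
      filter_upwards [hF, hF₁] with t e1 e2
      exact e2.ae_eq e1)
  have hc2 := coeff_mul (T := T) (m := fun ξ => (rieszSymbol (-α) ξ : ℂ))
    (Complex.measurable_ofReal.comp (measurable_rieszSymbol _)) (hint F) (hint F₂) (by
      filter_upwards [hF, hF₂] with t e1 e2
      exact e2.ae_eq e1)
  -- The condition `f(0) = f(T)` enters here: no boundary terms appear in the coefficients of `f_t`.
  have hc1' := coeff_timeDeriv_same hT hr1 hf' hF₁ hF₁' hper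
  have hmb : Measurable fun ξ => (besselSymbol (α / 2) ξ : ℂ) :=
    Complex.measurable_ofReal.comp (measurable_besselSymbol _)
  have hmr : Measurable fun ξ => (rieszSymbol α ξ : ℂ) :=
    Complex.measurable_ofReal.comp (measurable_rieszSymbol _)
  have hmq : ∀ k, Measurable (resolventSymbol κ α (freq T k)) :=
    fun k => measurable_resolventSymbol κ α (freq T k)
  have hmbq : ∀ k, Measurable fun ξ =>
      (besselSymbol (α / 2) ξ : ℂ) * resolventSymbol κ α (freq T k) ξ := fun k => hmb.mul (hmq k)
  have hmrq : ∀ k, Measurable fun ξ =>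
      (rieszSymbol α ξ : ℂ) * resolventSymbol κ α (freq T k) ξ := fun k => hmr.mul (hmq k)
  have hbd : ∀ k, ∀ᵐ ξ, ‖((besselSymbol (α / 2) ξ : ℂ) * resolventSymbol κ α (freq T k) ξ) *
      (coeff T k F : L2) ξ‖ ^ 2 ≤
      κ⁻¹ ^ 2 * ‖(coeff T k F₂ : L2) ξ‖ ^ 2 + κ⁻¹ ^ 2 * ‖(coeff T k F₁ : L2) ξ‖ ^ 2 := by
    intro k
    filter_upwards [hc1 k, hc2 k, ae_ne_zero] with ξ e1 e2 e3
    rw [e1, e2, norm_mul, norm_mul (rieszSymbol (-(α / 2)) ξ : ℂ),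
      norm_mul (rieszSymbol (-α) ξ : ℂ), mul_pow, mul_pow, mul_pow, Complex.norm_real,
      Complex.norm_real, Real.norm_eq_abs, Real.norm_eq_abs, sq_abs, sq_abs]
    calc _ ≤ (κ⁻¹ ^ 2 * (rieszSymbol (-α) ξ ^ 2 + rieszSymbol (-(α / 2)) ξ ^ 2)) *
          ‖(coeff T k F : L2) ξ‖ ^ 2 := by
          gcongr
          exact norm_bessel_resolvent_sq_le hκ h0 h2 _ e3
      _ = _ := by ring
  -- On the frequency side `U`, `A`, `U'` stand for `u`, `Λ^α u`, `u_t`, and `B`, `B'` for the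
  -- Bessel lifts of `u` and `u_t`.
  obtain ⟨B, hB, hBn⟩ := exists_multiplier hT hmbq hbd
  -- The bound for `B` serves again, since the Bessel symbol is at least one.
  obtain ⟨U, hU, -⟩ := exists_multiplier hT hmq (F := F) (X := F₂) (Y := F₁) (s := κ⁻¹ ^ 2)
    (t := κ⁻¹ ^ 2) (fun k => by
      filter_upwards [hbd k] with ξ e
      refine le_trans ?_ e
      have hb := one_le_besselSymbol hs ξ
      rw [mul_assoc, norm_mul (besselSymbol (α / 2) ξ : ℂ), Complex.norm_real, Real.norm_eq_abs,
        abs_of_nonneg (by linarith)]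
      gcongr
      exact le_mul_of_one_le_left (norm_nonneg _) hb)
  -- The norm of `f` in `L²` suffices here, so the second slot is filled with `0`.
  obtain ⟨A, hA, hAn⟩ := exists_multiplier hT hmrq (F := F) (X := F)
    (Y := 0) (s := κ⁻¹ ^ 2) (t := 0) (fun k => by
      filter_upwards [ae_ne_zero] with ξ e
      rw [norm_mul, mul_pow, zero_mul, add_zero]
      exact mul_le_mul_of_nonneg_right (norm_riesz_resolvent_sq_le hκ α _ e) (sq_nonneg _))
  obtain ⟨B', hB', hBn'⟩ := exists_multiplier hT
    (fun k => (hmbq k).const_mul ((freq T k : ℂ) * Complex.I)) (F := F) (X := F)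
    (Y := F₁') (s := 1) (t := κ⁻¹ ^ 2) (fun k => by
      filter_upwards [hc1 k, ae_ne_zero, Lp.coeFn_smul ((freq T k : ℂ) * Complex.I) (coeff T k F₁)]
        with ξ e1 e2 e3
      rw [hc1' k, e3, Pi.smul_apply, e1, norm_mul, norm_smul, norm_mul (freq T k : ℂ),
        Complex.norm_I, mul_one, norm_mul (rieszSymbol (-(α / 2)) ξ : ℂ), mul_pow, mul_pow,
        mul_pow, Complex.norm_real, Complex.norm_real, Real.norm_eq_abs, Real.norm_eq_abs,
        sq_abs, sq_abs]
      calc _ ≤ (1 + κ⁻¹ ^ 2 * (freq T k * rieszSymbol (-(α / 2)) ξ) ^ 2) *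
            ‖(coeff T k F : L2) ξ‖ ^ 2 := by
            gcongr
            exact norm_freq_bessel_resolvent_sq_le hκ h0 h2 _ e2
        _ = _ := by ring)
  obtain ⟨U', hU', -⟩ := exists_multiplier hT
    (fun k => (hmq k).const_mul ((freq T k : ℂ) * Complex.I)) (F := F) (X := F)
    (Y := 0) (s := 1) (t := 0) (fun k => ae_of_all _ fun ξ => by
      rw [norm_mul, mul_pow, zero_mul, add_zero]
      exact mul_le_mul_of_nonneg_right (norm_freq_resolvent_sq_le κ α _ ξ) (sq_nonneg _))
  have hUd : ∀ k, coeff T k U' = ((freq T k : ℂ) * Complex.I) • coeff T k U := by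
    intro k
    refine Lp.ext ?_
    filter_upwards [hU k, hU' k, Lp.coeFn_smul ((freq T k : ℂ) * Complex.I) (coeff T k U)]
      with ξ e1 e2 e3
    rw [e2, e3, Pi.smul_apply, e1, smul_eq_mul, mul_assoc]
  have hBd : ∀ k, coeff T k B' = ((freq T k : ℂ) * Complex.I) • coeff T k B := by
    intro k
    refine Lp.ext ?_
    filter_upwards [hB k, hB' k, Lp.coeFn_smul ((freq T k : ℂ) * Complex.I) (coeff T k B)]
      with ξ e1 e2 e3
    rw [e2, e3, Pi.smul_apply, e1, smul_eq_mul, mul_assoc]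
  have lB := isFourierLift_ofFourier hT (measurable_besselSymbol (α / 2)) (U := U) (V := B)
    (fun k => by
      filter_upwards [hU k, hB k] with ξ e1 e2
      rw [e1, e2, mul_assoc])
  have lB' := isFourierLift_ofFourier hT (measurable_besselSymbol (α / 2)) (U := U') (V := B')
    (fun k => by
      filter_upwards [hU' k, hB' k] with ξ e1 e2
      rw [e1, e2]
      ring)
  have lA := isFourierLift_ofFourier hT (measurable_rieszSymbol α) (U := U) (V := A)
    (fun k => by
      filter_upwards [hU k, hA k] with ξ e1 e2
      rw [e1, e2, mul_assoc])
  have hder := isTimeDeriv_of_coeff hT (Lp.memLp U) (Lp.memLp U') hUd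
  -- On coefficients this is `(iτ + κ r) q = 1`.
  have heq : ∀ᵐ t ∂(timeMeasure T), U' t + (κ : ℂ) • A t = F t := by
    refine ae_eq_of_coeff_eq hT ((Lp.memLp U').add ((Lp.memLp A).const_smul (κ : ℂ))) (Lp.memLp F)
      fun k => Lp.ext ?_
    have hsplit : coeff T k (fun t => U' t + (κ : ℂ) • A t) =
        coeff T k U' + (κ : ℂ) • coeff T k A := coeff_add_smul k _ (hint U') (hint A)
    rw [hsplit]
    filter_upwards [hU' k, hA k, ae_ne_zero, Lp.coeFn_add (coeff T k U') ((κ : ℂ) • coeff T k A),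
      Lp.coeFn_smul (κ : ℂ) (coeff T k A)] with ξ e1 e2 e3 e4 e5
    rw [e4, Pi.add_apply, e5, Pi.smul_apply, e1, e2, smul_eq_mul]
    have hne := resolvent_denom_ne_zero hκ α (freq T k) e3
    have : resolventSymbol κ α (freq T k) ξ * ((freq T k : ℂ) * Complex.I +
        ((κ * rieszSymbol α ξ : ℝ) : ℂ)) = 1 := inv_mul_cancel₀ hne
    push_cast at this
    linear_combination (coeff T k F : L2) ξ * this
  have hle : normY α T (fun t => ofFourier (U t)) ≤
      ENNReal.ofReal (1 + 1 / κ) * normX α T f := by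
    have hkey := sum_norms_le hκ (norm_nonneg F₂) (norm_nonneg F) hBn
      (by rwa [one_mul] at hBn') (by rwa [zero_mul, add_zero] at hAn) (C := ‖F₁'‖) (M := ‖A‖)
    calc normY α T (fun t => ofFourier (U t))
        ≤ ENNReal.ofReal √(‖B‖ ^ 2 + ‖B'‖ ^ 2) + ENNReal.ofReal ‖A‖ := by
          refine add_le_add ?_ (normL2_eq_ofReal lA).le
          refine (iInf₂_le _ hder).trans (le_of_eq ?_)
          rw [normL2_eq_ofReal lB, normL2_eq_ofReal lB',
            rpow_half_ofReal (norm_nonneg _) (norm_nonneg _)]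
      _ = ENNReal.ofReal (√(‖B‖ ^ 2 + ‖B'‖ ^ 2) + ‖A‖) :=
          (ENNReal.ofReal_add (Real.sqrt_nonneg _) (norm_nonneg _)).symm
      _ ≤ ENNReal.ofReal ((1 + 1 / κ) * (√(‖F₁‖ ^ 2 + ‖F₁'‖ ^ 2) + ‖F‖ + ‖F₂‖)) :=
          ENNReal.ofReal_le_ofReal hkey
      _ = ENNReal.ofReal (1 + 1 / κ) * (ENNReal.ofReal √(‖F₁‖ ^ 2 + ‖F₁'‖ ^ 2) +
            ENNReal.ofReal ‖F‖ + ENNReal.ofReal ‖F₂‖) := by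
          rw [ENNReal.ofReal_mul (by positivity), ENNReal.ofReal_add (by positivity)
            (norm_nonneg _), ENNReal.ofReal_add (Real.sqrt_nonneg _) (norm_nonneg _)]
      _ ≤ ENNReal.ofReal (1 + 1 / κ) * normX α T f := by
          gcongr
          exact add_le_add (add_le_add (le_normH1 hT hr1 hF₁ hper hc1')
            (normL2_eq_ofReal hFl).ge) (normL2_eq_ofReal hF₂).ge
  refine ⟨fun t => ofFourier (U t),
    ⟨hle.trans_lt (ENNReal.mul_lt_top ENNReal.ofReal_lt_top hf), ⟨_, hder, ?_⟩,
      eqAtEndpoints_ofFourier hs hT lB hBd⟩, hle,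
    fun v hv => ae_eq_of_isPeriodicStrongSolution hκ h0 hT hF hU hv,
    isRealDistribution_ofFourier hT hF hU⟩
  filter_upwards [heq, lA, hF] with t e1 e2 e3
  refine ⟨𝓕⁻ (A t), sobolevLift_fourierInv e2, ?_⟩
  refine IsFourierFun.eq (((isFourierFun_ofFourier (U' t)).add
    ((isFourierFun_ofFourier (A t)).smul (κ : ℂ))).congr ?_) e3
  filter_upwards [Lp.coeFn_add (U' t) ((κ : ℂ) • A t), Lp.coeFn_smul (κ : ℂ) (A t)] with ξ g1 g2
  rw [← e1, g1, Pi.add_apply, g2, Pi.smul_apply, smul_eq_mul]
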